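/- Let $\mathcal X$ be a set (of contexts) and let $\mathcal H$ be a nonempty, possibly infinite, class of functions $h:\mathcal X\to\mathbb R$ with $|h(x)|\le B$ for all $h\in\mathcal H$, $x\in\mathcal X$. Let $\beta\ge 0$, and suppose that $\mathcal H$ has a finite $\beta$-cover in the $L_\infty$ metric, i.e. a finite set $\mathcal H'\subseteq\mathcal H$ such that for every $h\in\mathcal H$ there is $h'\in\mathcal H'$ with $\sup_{x\in\mathcal X}|h(x)-h'(x)|\le\beta$. Let $\mathcal H_\beta=\{h^1,\dots,h^N\}$ be a $\beta$-cover of the smallest possible size $N=|\mathcal H_\beta|$, and let $T\ge 1$ be the horizon. Online protocol: the learner fixes an integer $m\ge 1$ and uses the forecasts $\mathcal P=\{0,\tfrac1m,\dots,1\}$. In each round $t=1,\dots,T$ an arbitrary adversary (adaptive to all earlier rounds, and possibly randomized) selects a context $x_t\in\mathcal X$ and a label $y_t\in[0,1]$; the learner sees $x_t$, selects a probability distribution $w_t$ on $\mathcal P$, outputs $p_t\in\mathcal P$ drawn from $w_t$, and then observes $y_t$. For the transcript $\pi_T=(x_t,y_t,p_t)_{t=1}^T$ put $$K(\pi_T,h)=\sum_{p\in\mathcal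 P}\frac1T\Big|\sum_{t\le T:\,p_t=p}h(x_t)(y_t-p_t)\Big|,\qquad K(\pi_T,\mathcal H)=\sup_{h\in\mathcal H}K(\pi_T,h).$$ There are an absolute constant $C$, a polynomial $q$ and a single algorithm such that, for all $\mathcal X,\mathcal H,B,\beta,\mathcal H_\beta,T$ as above and against every such adversary, the algorithm, given $T$, $N$, $B$ and, in each round $t$, access to the values $h^1(x_t),\dots,h^N(x_t)$, satisfies $$\mathbb E\big[K(\pi_T,\mathcal H)\big]\;\le\; C\,B\,T^{-1/3}\sqrt{\log\big(6T|\mathcal H_\beta|\big)}+\beta ,$$ and its total running time over the $T$ rounds is at most $|\mathcal H_\beta|\cdot q(T)$ on every transcript. Running time is counted on a real RAM: one step for each arithmetic operation, comparison, memory access, and evaluation of some $h^i$ at the current context $x_t$, and $m+1$ steps for drawing a forecast from $w_t$. -/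

import Mathlib

/-! ## Machine model: a real RAM with structured control flow

The memory holds natural-number index registers and finitely many named (two-dimensional) arrays
of real numbers.  Every arithmetic operation, comparison, memory access and query costs one step;
a program is a finite text that does not depend on the input. -/

namespace RealRAM

/-- Memory: index registers `nat r` and array cells `arr a i j`. -/
structure State where
  nat : ℕ → ℕ
  arr : ℕ → ℕ → ℕ → ℝ

/-- Index expressions: literals, registers, sums and truncated differences. -/
inductive NExpr where
  | lit (n : ℕ)
  | reg (r : ℕ)
  | add (e₁ e₂ : NExpr)
  | sub (e₁ e₂ : NExpr)

namespace NExpr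

/-- Value of an index expression. -/
def eval (s : State) : NExpr → ℕ
  | lit n => n
  | reg r => s.nat r
  | add e₁ e₂ => eval s e₁ + eval s e₂
  | sub e₁ e₂ => eval s e₁ - eval s e₂

/-- Number of operations in an index expression. -/
def size : NExpr → ℕ
  | lit _ => 1
  | reg _ => 1
  | add e₁ e₂ => size e₁ + size e₂ + 1
  | sub e₁ e₂ => size e₁ + size e₂ + 1

end NExpr

/-- Real expressions: rational literals, conversion of an index, array cells, queries to the
current oracle, and the four arithmetic operations. -/
inductive RExpr where
  | lit (c : ℚ)
  | ofIndex (e : NExpr)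
  | cell (a : ℕ) (i j : NExpr)
  | query (i : NExpr)
  | add (e₁ e₂ : RExpr)
  | sub (e₁ e₂ : RExpr)
  | mul (e₁ e₂ : RExpr)
  | div (e₁ e₂ : RExpr)

namespace RExpr

/-- Value of a real expression; `orc` is the current oracle. -/
noncomputable def eval (orc : ℕ → ℝ) (s : State) : RExpr → ℝ
  | lit c => (c : ℝ)
  | ofIndex e => (e.eval s : ℝ)
  | cell a i j => s.arr a (i.eval s) (j.eval s)
  | query i => orc (i.eval s)
  | add e₁ e₂ => eval orc s e₁ + eval orc s e₂
  | sub e₁ e₂ => eval orc s e₁ - eval orc s e₂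
  | mul e₁ e₂ => eval orc s e₁ * eval orc s e₂
  | div e₁ e₂ => eval orc s e₁ / eval orc s e₂

/-- Number of operations in a real expression. -/
def size : RExpr → ℕ
  | lit _ => 1
  | ofIndex e => e.size + 1
  | cell _ i j => i.size + j.size + 1
  | query i => i.size + 1
  | add e₁ e₂ => size e₁ + size e₂ + 1
  | sub e₁ e₂ => size e₁ + size e₂ + 1
  | mul e₁ e₂ => size e₁ + size e₂ + 1
  | div e₁ e₂ => size e₁ + size e₂ + 1

end RExpr

/-- Store the index `n` in register `r`. -/
def State.setNat (s : State) (r n : ℕ) : State where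
  nat := fun r' => if r' = r then n else s.nat r'
  arr := s.arr

/-- Store the real `v` in the cell `(i, j)` of array `a`. -/
def State.setArr (s : State) (a i j : ℕ) (v : ℝ) : State where
  nat := s.nat
  arr := fun a' i' j' => if a' = a ∧ i' = i ∧ j' = j then v else s.arr a' i' j'

/-- Programs.  `loop e p` runs `p` as many times as the value of `e` on entry. -/
inductive Prog where
  | skip
  | setNat (r : ℕ) (e : NExpr)
  | setArr (a : ℕ) (i j : NExpr) (e : RExpr)
  | seq (p₁ p₂ : Prog)
  | iteNat (e₁ e₂ : NExpr) (p₁ p₂ : Prog)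
  | iteReal (e₁ e₂ : RExpr) (p₁ p₂ : Prog)
  | loop (e : NExpr) (p : Prog)

namespace Prog

/-- The memory after running a program.  The conditionals test `e₁ ≤ e₂`. -/
noncomputable def exec (orc : ℕ → ℝ) : Prog → State → State
  | skip, s => s
  | setNat r e, s => s.setNat r (e.eval s)
  | setArr a i j e, s => s.setArr a (i.eval s) (j.eval s) (e.eval orc s)
  | seq p₁ p₂, s => exec orc p₂ (exec orc p₁ s)
  | iteNat e₁ e₂ p₁ p₂, s => if e₁.eval s ≤ e₂.eval s then exec orc p₁ s else exec orc p₂ s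
  | iteReal e₁ e₂ p₁ p₂, s =>
      if e₁.eval orc s ≤ e₂.eval orc s then exec orc p₁ s else exec orc p₂ s
  | loop e p, s => (exec orc p)^[e.eval s] s

/-- The number of steps of a run of a program. -/
noncomputable def time (orc : ℕ → ℝ) : Prog → State → ℕ
  | skip, _ => 1
  | setNat _ e, _ => e.size + 1
  | setArr _ i j e, _ => i.size + j.size + e.size + 1
  | seq p₁ p₂, s => time orc p₁ s + time orc p₂ (exec orc p₁ s)
  | iteNat e₁ e₂ p₁ p₂, s => e₁.size + e₂.size + 1 +
      (if e₁.eval s ≤ e₂.eval s then time orc p₁ s else time orc p₂ s)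
  | iteReal e₁ e₂ p₁ p₂, s => e₁.size + e₂.size + 1 +
      (if e₁.eval orc s ≤ e₂.eval orc s then time orc p₁ s else time orc p₂ s)
  | loop e p, s => e.size + 1 +
      ∑ k ∈ Finset.range (e.eval s), (1 + time orc p ((exec orc p)^[k] s))

end Prog

end RealRAM

/-! ## Online multicalibration -/

namespace Multicalibration

open RealRAM

/-- One round of a transcript: the context `x`, the label `y ∈ [0, 1]`, and the index `p` of the
forecast `p / m ∈ {0, 1/m, …, 1}`. -/
structure Round (X : Type*) (m : ℕ) where
  x : X
  y : unitInterval
  p : Fin (m + 1)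

/-- Histories list their rounds with the most recent one first. -/
abbrev History (X : Type*) (m : ℕ) := List (Round X m)

/-- A deterministic adaptive adversary picks the context and the label of the next round from the
whole past, before the forecast of that round is drawn. -/
abbrev Adversary (X : Type*) (m : ℕ) := History X m → X × unitInterval

/-- `K(π, h) = ∑_p (1/T) |∑_{t : p_t = p} h(x_t) (y_t - p_t)|`, where `T` is the length of `π`. -/
noncomputable def calError {X : Type*} {m : ℕ} (π : History X m) (h : X → ℝ) : ℝ :=
  ∑ i : Fin (m + 1), (1 / (π.length : ℝ)) *
    |((π.filter fun r => r.p = i).map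
        fun r => h r.x * ((r.y : ℝ) - ((r.p : ℕ) : ℝ) / (m : ℝ))).sum|

/-- `K(π, H) = sup_{h ∈ H} K(π, h)`. -/
noncomputable def multicalError {X : Type*} {m : ℕ} (π : History X m) (H : Set (X → ℝ)) : ℝ :=
  ⨆ h : H, calError π (h : X → ℝ)

/-- The expected value of `F` at the final transcript, when the history so far is `π`, there are
`n` more rounds, the adversary is `A`, and in every round the forecast has index `i` with
conditional probability `w π x i` given the past history `π` and the present context `x`. -/
noncomputable def expectedValue {X : Type*} {m : ℕ} (w : History X m → X → Fin (m + 1) → ℝ)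
    (A : Adversary X m) (F : History X m → ℝ) : ℕ → History X m → ℝ
  | 0, π => F π
  | n + 1, π => ∑ i : Fin (m + 1),
      w π (A π).1 i * expectedValue w A F n (⟨(A π).1, (A π).2, i⟩ :: π)

/-- `S` is a (finite) `β`-cover of `H` in the `L∞` metric. -/
def IsCover {X : Type*} (H : Set (X → ℝ)) (β : ℝ) (S : Finset (X → ℝ)) : Prop :=
  (S : Set (X → ℝ)) ⊆ H ∧ ∀ h ∈ H, ∃ g ∈ S, ∀ x, |h x - g x| ≤ β

/-- `S` is a `β`-cover of `H` of the smallest possible size. -/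
def IsMinimalCover {X : Type*} (H : Set (X → ℝ)) (β : ℝ) (S : Finset (X → ℝ)) : Prop :=
  IsCover H β S ∧ ∀ S' : Finset (X → ℝ), IsCover H β S' → S.card ≤ S'.card

/-- An online forecasting algorithm: a program that runs before the first round, one that runs in
each round after the context is revealed, and one that runs after the label is revealed. -/
structure Algorithm where
  init : Prog
  predict : Prog
  update : Prog

namespace Algorithm

/-- The input: the horizon `T` (register 0), the number `N` of available functions (register 1)
and their bound `B` (cell `(0, 0)` of array 0); everything else is zero. -/
noncomputable def input (T N : ℕ) (B : ℝ) : State where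
  nat := fun r => if r = 0 then T else if r = 1 then N else 0
  arr := fun a i j => if a = 0 ∧ i = 0 ∧ j = 0 then B else 0

/-- In a round with context `x`, query `i` returns the value at `x` of the `i`-th function. -/
def oracle {X : Type*} {N : ℕ} (g : Fin N → X → ℝ) (x : X) (i : ℕ) : ℝ :=
  if hi : i < N then g ⟨i, hi⟩ x else 0

/-- The memory before the first round (no context is available yet). -/
noncomputable def startState (alg : Algorithm) (T N : ℕ) (B : ℝ) : State :=
  alg.init.exec (fun _ => 0) (input T N B)

/-- The discretization parameter `m` chosen by the algorithm (register 2 before round one). -/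
noncomputable def discretization (alg : Algorithm) (T N : ℕ) (B : ℝ) : ℕ :=
  (alg.startState T N B).nat 2

/-- The memory just before the update, in a round that began with memory `s`: the forecast
index (register 3) and the label (cell `(0, 1)` of array 0) have been stored. -/
noncomputable def beforeUpdate {X : Type*} {m N : ℕ} (alg : Algorithm) (g : Fin N → X → ℝ)
    (s : State) (r : Round X m) : State :=
  ((alg.predict.exec (oracle g r.x) s).setNat 3 r.p).setArr 0 0 1 r.y

/-- The memory after a given history. -/
noncomputable def stateAfter {X : Type*} {m N : ℕ} (alg : Algorithm) (g : Fin N → X → ℝ)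
    (T : ℕ) (B : ℝ) : History X m → State
  | [] => alg.startState T N B
  | r :: π => alg.update.exec (oracle g r.x) (alg.beforeUpdate g (stateAfter alg g T B π) r)

/-- The forecast weights `w(0), …, w(m)` that the algorithm selects after history `π` at context
`x`: the cells `(0, 0), …, (0, m)` of array 1 when the prediction program ends. -/
noncomputable def weights {X : Type*} {m N : ℕ} (alg : Algorithm) (g : Fin N → X → ℝ)
    (T : ℕ) (B : ℝ) (π : History X m) (x : X) (i : Fin (m + 1)) : ℝ :=
  (alg.predict.exec (oracle g x) (alg.stateAfter g T B π)).arr 1 0 i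

/-- The total number of steps along a given history.  Drawing the forecast from the selected
weights is charged `m + 1` steps per round. -/
noncomputable def runTime {X : Type*} {m N : ℕ} (alg : Algorithm) (g : Fin N → X → ℝ)
    (T : ℕ) (B : ℝ) : History X m → ℕ
  | [] => alg.init.time (fun _ => 0) (input T N B)
  | r :: π => runTime alg g T B π
      + alg.predict.time (oracle g r.x) (alg.stateAfter g T B π)
      + (m + 1)
      + alg.update.time (oracle g r.x) (alg.beforeUpdate g (alg.stateAfter g T B π) r)

/-- `E[K(π_T, H)]` for the algorithm against a deterministic adaptive adversary. -/
noncomputable def expectedError {X : Type*} {m N : ℕ} (alg : Algorithm) (g : Fin N → X → ℝ)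
    (T : ℕ) (B : ℝ) (H : Set (X → ℝ)) (A : Adversary X m) : ℝ :=
  expectedValue (alg.weights g T B) A (fun π => multicalError π H) T []

end Algorithm

end Multicalibration

/-!
Each function `g i` of the cover is tested by a gambler who, in a round with forecast `p`, bets on
the return `z = η * g i x * (y - p)` in the account of `p`.  The capital of every account is split
between bets on `z` and on `-z`, so that whichever sign the sum of the returns of an account turns
out to have, one of the halves grows exponentially in its absolute value.  Hence the logarithm of
the gambler's potential, which is the product of his accounts, bounds `η * T` times the calibration
error against `g i`, up to `log 2` per forecast and a second-order term `2 * (η * B) ^ 2` per round.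

The forecaster defends against all gamblers at once.  After the context is revealed, the total
potential is affine in the residual `y - p`, with a slope (the score of `p`) that does not depend
on `y`.  If the score changes sign between two adjacent forecasts, randomizing between them so that
its mean is zero makes the total potential grow in expectation by a factor of at most
`1 + η * B / m`, whatever the label; otherwise an extreme forecast does even better.  Jensen's
inequality for the logarithm, `η = 1 / (2 * B * m)` and `m ≈ T ^ (1 / 3)` give the rate, and passing
from the cover to the whole class costs `β`.
-/

namespace Multicalibration

/-! ## Hedged betting -/

section Betting

variable {ι κ : Type*} [DecidableEq κ] {b : ι → κ} {z : ι → ℝ}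

/-- The wealth in the `k`-th account of a gambler who starts with `1` in each of the accounts and
bets everything in account `b a` on the return `z a`, for every `a` in the list. -/
noncomputable def wealth (b : ι → κ) (z : ι → ℝ) (l : List ι) (k : κ) : ℝ :=
  ((l.filter fun a => b a = k).map fun a => 1 + z a).prod

/-- The signed fraction of the wealth in account `k` that is at stake when half of the starting
capital is bet on the returns `z` and the other half on `-z`. -/
noncomputable def stake (b : ι → κ) (z : ι → ℝ) (l : List ι) (k : κ) : ℝ :=
  (wealth b z l k - wealth b (-z) l k) / (wealth b z l k + wealth b (-z) l k)

/-- The product over all accounts of the wealth of the hedged strategy, i.e. the average of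
`∏ a ∈ l, (1 + s (b a) * z a)` over all sign patterns `s : κ → {-1, 1}`. -/
noncomputable def potential [Fintype κ] (b : ι → κ) (z : ι → ℝ) (l : List ι) : ℝ :=
  ∏ k, (wealth b z l k + wealth b (-z) l k) / 2

theorem wealth_cons_self (a : ι) (l : List ι) :
    wealth b z (a :: l) (b a) = wealth b z l (b a) * (1 + z a) := by
  simp [wealth, mul_comm]

theorem wealth_cons_of_ne {a : ι} {k : κ} (h : b a ≠ k) (l : List ι) :
    wealth b z (a :: l) k = wealth b z l k := by
  simp [wealth, h]

theorem wealth_pos (hz : ∀ a, |z a| < 1) (l : List ι) (k : κ) : 0 < wealth b z l k := by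
  refine List.prod_pos fun v hv => ?_
  obtain ⟨a, -, rfl⟩ := List.mem_map.1 hv
  linarith [(abs_lt.1 (hz a)).1]

theorem wealth_neg_pos (hz : ∀ a, |z a| < 1) (l : List ι) (k : κ) : 0 < wealth b (-z) l k :=
  wealth_pos (fun a => (abs_neg (z a)).trans_lt (hz a)) l k

theorem wealth_add_wealth_neg_pos (hz : ∀ a, |z a| < 1) (l : List ι) (k : κ) :
    0 < wealth b z l k + wealth b (-z) l k :=
  add_pos (wealth_pos hz l k) (wealth_neg_pos hz l k)

theorem abs_stake_lt_one (hz : ∀ a, |z a| < 1) (l : List ι) (k : κ) : |stake b z l k| < 1 := by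
  have hpos := wealth_pos (b := b) hz l k
  have hneg := wealth_neg_pos (b := b) hz l k
  have hsum := add_pos hpos hneg
  rw [stake, abs_div, abs_of_pos hsum, div_lt_one hsum, abs_lt]
  constructor <;> linarith

theorem stake_cons_of_ne {a : ι} {k : κ} (h : b a ≠ k) (l : List ι) :
    stake b z (a :: l) k = stake b z l k := by
  simp only [stake, wealth_cons_of_ne h]

theorem stake_cons_self (hz : ∀ a, |z a| < 1) (a : ι) (l : List ι) :
    stake b z (a :: l) (b a) =
      (stake b z l (b a) + z a) / (1 + z a * stake b z l (b a)) := by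
  have hsum := (wealth_add_wealth_neg_pos (b := b) hz l (b a)).ne'
  simp only [stake, wealth_cons_self, Pi.neg_apply]
  field_simp
  congr 1 <;> ring

theorem sub_two_mul_sq_le_log_one_add {x : ℝ} (hx : |x| ≤ 1 / 2) :
    x - 2 * x ^ 2 ≤ Real.log (1 + x) := by
  have hx' : 0 < 1 + x := by linarith [(abs_le.1 hx).1]
  refine le_trans ?_ (Real.one_sub_inv_le_log_of_pos hx')
  have hsub : 1 - (1 + x)⁻¹ - (x - 2 * x ^ 2) = x ^ 2 * (1 + 2 * x) / (1 + x) := by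
    field_simp
    ring
  have : 0 ≤ 1 + 2 * x := by linarith [(abs_le.1 hx).1]
  have : 0 ≤ 1 - (1 + x)⁻¹ - (x - 2 * x ^ 2) := hsub ▸ by positivity
  linarith

theorem sum_le_log_prod_one_add {δ : ℝ} (hδ : δ ≤ 1 / 2) (hz : ∀ a, |z a| ≤ δ) (l : List ι) :
    (l.map z).sum ≤ Real.log (l.map fun a => 1 + z a).prod + l.length * (2 * δ ^ 2) := by
  have hlt (a : ι) : |z a| < 1 := by linarith [hz a]
  have hterm (a : ι) : z a ≤ Real.log (1 + z a) + 2 * δ ^ 2 := by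
    have hsq : z a ^ 2 ≤ δ ^ 2 := sq_le_sq' (neg_le_of_abs_le (hz a)) (le_of_abs_le (hz a))
    linarith [sub_two_mul_sq_le_log_one_add ((hz a).trans hδ)]
  rw [Real.log_list_prod (by
    simp only [List.mem_map, forall_exists_index, and_imp, forall_apply_eq_imp_iff₂]
    exact fun a _ => by linarith [(abs_lt.1 (hlt a)).1]), List.map_map]
  calc (l.map z).sum ≤ (l.map fun a => Real.log (1 + z a) + 2 * δ ^ 2).sum :=
        List.sum_le_sum fun a _ => hterm a
    _ = _ := by simp [List.sum_map_add, List.map_const', Function.comp_def]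

theorem abs_sum_le_log_wealth {δ : ℝ} (hδ : δ ≤ 1 / 2) (hz : ∀ a, |z a| ≤ δ) (l : List ι)
    (k : κ) :
    |((l.filter fun a => b a = k).map z).sum| ≤
      Real.log (wealth b z l k + wealth b (-z) l k) +
        (l.filter fun a => b a = k).length * (2 * δ ^ 2) := by
  have hlt (a : ι) : |z a| < 1 := by linarith [hz a]
  have hpos := wealth_pos (b := b) hlt l k
  have hneg := wealth_neg_pos (b := b) hlt l k
  have hup := sum_le_log_prod_one_add hδ hz (l.filter fun a => b a = k)
  have hdown := sum_le_log_prod_one_add (z := -z) hδ (fun a => (abs_neg (z a)).trans_le (hz a))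
    (l.filter fun a => b a = k)
  have hsum : ((l.filter fun a => b a = k).map (-z)).sum =
      -((l.filter fun a => b a = k).map z).sum := by
    induction l.filter fun a => b a = k <;> simp_all [add_comm]
  rw [hsum] at hdown
  have hlogup : Real.log (wealth b z l k) ≤ Real.log (wealth b z l k + wealth b (-z) l k) :=
    Real.log_le_log hpos (by linarith)
  have hlogdown : Real.log (wealth b (-z) l k) ≤
      Real.log (wealth b z l k + wealth b (-z) l k) := Real.log_le_log hneg (by linarith)
  simp only [wealth] at hlogup hlogdown ⊢
  exact abs_le.2 ⟨by linarith, by linarith⟩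

variable [Fintype κ]

@[simp]
theorem potential_nil : potential b z [] = 1 := by
  simp [potential, wealth]

theorem potential_pos (hz : ∀ a, |z a| < 1) (l : List ι) : 0 < potential b z l :=
  Finset.prod_pos fun k _ => half_pos (wealth_add_wealth_neg_pos hz l k)

theorem potential_cons (hz : ∀ a, |z a| < 1) (a : ι) (l : List ι) :
    potential b z (a :: l) = potential b z l * (1 + z a * stake b z l (b a)) := by
  have hfactor (k : κ) : (wealth b z (a :: l) k + wealth b (-z) (a :: l) k) / 2 =
      (wealth b z l k + wealth b (-z) l k) / 2 *
        if k = b a then 1 + z a * stake b z l (b a) else 1 := by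
    split_ifs with h
    · subst h
      have hsum := (wealth_add_wealth_neg_pos (b := b) hz l (b a)).ne'
      simp only [stake, wealth_cons_self, Pi.neg_apply]
      field_simp
      ring
    · simp only [wealth_cons_of_ne (Ne.symm h), mul_one]
  simp only [potential, hfactor, Finset.prod_mul_distrib, Finset.prod_ite_eq', Finset.mem_univ,
    if_true]

theorem sum_sum_map_filter {M : Type*} [AddCommMonoid M] (f : ι → M) (l : List ι) :
    ∑ k, ((l.filter fun a => b a = k).map f).sum = (l.map f).sum := by
  induction l with
  | nil => simp
  | cons a l ih =>
    have hcons (k : κ) : (((a :: l).filter fun a => b a = k).map f).sum =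
        (if k = b a then f a else 0) + ((l.filter fun a => b a = k).map f).sum := by
      by_cases h : b a = k
      · simp [h]
      · simp [h, Ne.symm h]
    simp only [hcons, Finset.sum_add_distrib, Finset.sum_ite_eq', Finset.mem_univ, if_true, ih,
      List.map_cons, List.sum_cons]

theorem sum_length_filter (l : List ι) : ∑ k, (l.filter fun a => b a = k).length = l.length := by
  simpa only [List.map_const', List.sum_replicate, smul_eq_mul, mul_one] using
    sum_sum_map_filter (b := b) (fun _ => (1 : ℕ)) l

theorem sum_abs_sum_le_log_potential {δ : ℝ} (hδ : δ ≤ 1 / 2) (hz : ∀ a, |z a| ≤ δ)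
    (l : List ι) :
    ∑ k, |((l.filter fun a => b a = k).map z).sum| ≤
      Real.log (potential b z l) + Fintype.card κ * Real.log 2 + l.length * (2 * δ ^ 2) := by
  have hlt (a : ι) : |z a| < 1 := by linarith [hz a]
  have hsum (k : κ) := (wealth_add_wealth_neg_pos (b := b) hlt l k).ne'
  have hlog : Real.log (potential b z l) =
      ∑ k, Real.log (wealth b z l k + wealth b (-z) l k) - Fintype.card κ * Real.log 2 := by
    rw [potential, Real.log_prod fun k _ => div_ne_zero (hsum k) two_ne_zero]
    simp [Real.log_div (hsum _) two_ne_zero]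
  calc _ ≤ ∑ k, (Real.log (wealth b z l k + wealth b (-z) l k) +
          (l.filter fun a => b a = k).length * (2 * δ ^ 2)) :=
        Finset.sum_le_sum fun k _ => abs_sum_le_log_wealth hδ hz l k
    _ = _ := by
        rw [Finset.sum_add_distrib, ← Finset.sum_mul, ← Nat.cast_sum, sum_length_filter, hlog]
        ring

end Betting

/-! ## Calibration error of balanced forecasts -/

section Expectation

variable {X : Type*} {m : ℕ} {w : History X m → X → Fin (m + 1) → ℝ} {A : Adversary X m}
  {F G : History X m → ℝ}

theorem expectedValue_mono (hw : ∀ π x i, 0 ≤ w π x i) {n : ℕ} {π : History X m}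
    (hFG : ∀ π' : History X m, π'.length = π.length + n → F π' ≤ G π') :
    expectedValue w A F n π ≤ expectedValue w A G n π := by
  induction n generalizing π with
  | zero => exact hFG π rfl
  | succ n ih =>
    refine Finset.sum_le_sum fun i _ => mul_le_mul_of_nonneg_left ?_ (hw _ _ _)
    exact ih fun π' h => hFG π' (by rw [h, List.length_cons, Nat.add_right_comm, Nat.add_assoc])

theorem expectedValue_mul_add (hw : ∀ π x, ∑ i, w π x i = 1) (F : History X m → ℝ) (a b : ℝ)
    (n : ℕ) (π : History X m) :
    expectedValue w A (fun π => a * F π + b) n π = a * expectedValue w A F n π + b := by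
  induction n generalizing π with
  | zero => rfl
  | succ n ih =>
    simp only [expectedValue, ih, mul_add, Finset.sum_add_distrib, ← Finset.sum_mul, hw, one_mul,
      Finset.mul_sum, mul_left_comm a]

theorem expectedValue_const (hw : ∀ π x, ∑ i, w π x i = 1) (b : ℝ) (n : ℕ) (π : History X m) :
    expectedValue w A (fun _ => b) n π = b := by
  simpa using expectedValue_mul_add (A := A) hw (fun _ => 0) 0 b n π

theorem expectedValue_le_pow_mul (hw : ∀ π x i, 0 ≤ w π x i) {ρ : ℝ} (hρ : 0 ≤ ρ)
    (hF : ∀ π x y, ∑ i, w π x i * F (⟨x, y, i⟩ :: π) ≤ ρ * F π) (n : ℕ) (π : History X m) :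
    expectedValue w A F n π ≤ ρ ^ n * F π := by
  induction n generalizing π with
  | zero => simp [expectedValue]
  | succ n ih =>
    calc expectedValue w A F (n + 1) π
        ≤ ∑ i, w π (A π).1 i * (ρ ^ n * F (⟨(A π).1, (A π).2, i⟩ :: π)) :=
          Finset.sum_le_sum fun i _ => mul_le_mul_of_nonneg_left (ih _) (hw _ _ _)
      _ = ρ ^ n * ∑ i, w π (A π).1 i * F (⟨(A π).1, (A π).2, i⟩ :: π) := by
          simp only [Finset.mul_sum, mul_left_comm (ρ ^ n)]
      _ ≤ ρ ^ n * (ρ * F π) := mul_le_mul_of_nonneg_left (hF _ _ _) (by positivity)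
      _ = ρ ^ (n + 1) * F π := by ring

theorem expectedValue_log_le (hw : ∀ π x, w π x ∈ stdSimplex ℝ (Fin (m + 1)))
    (hF : ∀ π, 0 < F π) {M : ℝ} (hM : 0 < M) {n : ℕ} {π : History X m}
    (hFM : expectedValue w A F n π ≤ M) :
    expectedValue w A (fun π => Real.log (F π)) n π ≤ Real.log M := by
  have htangent (π : History X m) : Real.log (F π) ≤ M⁻¹ * F π + (Real.log M - 1) := by
    have := Real.log_le_sub_one_of_pos (div_pos (hF π) hM)
    rw [Real.log_div (hF π).ne' hM.ne', div_eq_inv_mul] at this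
    linarith
  calc expectedValue w A (fun π => Real.log (F π)) n π
      ≤ M⁻¹ * expectedValue w A F n π + (Real.log M - 1) :=
        (expectedValue_mono (fun π x => (hw π x).1) fun π _ => htangent π).trans_eq
          (expectedValue_mul_add (fun π x => (hw π x).2) F _ _ n π)
    _ ≤ M⁻¹ * M + (Real.log M - 1) := by gcongr
    _ = Real.log M := by rw [inv_mul_cancel₀ hM.ne']; ring

end Expectation

section CalibrationError

variable {X : Type*} {m : ℕ}

/-- The label minus the forecast of a round. -/
noncomputable def Round.residual (r : Round X m) : ℝ := r.y - (r.p : ℕ) / m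

theorem Round.abs_residual_le_one (r : Round X m) : |r.residual| ≤ 1 := by
  have hforecast : ((r.p : ℕ) : ℝ) / m ≤ 1 :=
    div_le_one_of_le₀ (by exact_mod_cast Fin.is_le r.p) (Nat.cast_nonneg m)
  have : 0 ≤ ((r.p : ℕ) : ℝ) / m := by positivity
  rw [Round.residual, abs_le]
  constructor <;> linarith [r.y.2.1, r.y.2.2]

theorem length_mul_calError (π : History X m) (h : X → ℝ) :
    π.length * calError π h =
      ∑ k, |((π.filter fun r => r.p = k).map fun r => h r.x * r.residual).sum| := by
  rcases eq_or_ne π [] with rfl | hπ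
  · simp
  · have : (π.length : ℝ) ≠ 0 := by simpa using hπ
    simp only [calError, ← Finset.mul_sum]
    field_simp
    rfl

theorem calError_nonneg (π : History X m) (h : X → ℝ) : 0 ≤ calError π h :=
  Finset.sum_nonneg fun _ _ => by positivity

theorem abs_sum_map_le {ι : Type*} {f : ι → ℝ} {c : ℝ} (hf : ∀ a, |f a| ≤ c) (l : List ι) :
    |(l.map f).sum| ≤ l.length * c := by
  induction l with
  | nil => simp
  | cons a l ih =>
    rw [List.map_cons, List.sum_cons, List.length_cons, Nat.cast_succ, add_one_mul, add_comm]
    exact (abs_add_le _ _).trans (add_le_add ih (hf a))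

theorem calError_le_add {π : History X m} (hπ : π ≠ []) {h g : X → ℝ} {β : ℝ}
    (hg : ∀ x, |h x - g x| ≤ β) : calError π h ≤ calError π g + β := by
  have hterm (r : Round X m) : |(h r.x - g r.x) * r.residual| ≤ β := by
    rw [abs_mul]
    exact (mul_le_of_le_one_right (abs_nonneg _) r.abs_residual_le_one).trans (hg r.x)
  have hbucket (k : Fin (m + 1)) :
      |((π.filter fun r => r.p = k).map fun r => h r.x * r.residual).sum| ≤
        |((π.filter fun r => r.p = k).map fun r => g r.x * r.residual).sum| +
          (π.filter fun r => r.p = k).length * β := by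
    have hsplit (l : History X m) : (l.map fun r => h r.x * r.residual).sum =
        (l.map fun r => g r.x * r.residual).sum +
          (l.map fun r => (h r.x - g r.x) * r.residual).sum := by
      simp only [← List.sum_map_add, ← add_mul, add_sub_cancel]
    rw [hsplit]
    exact (abs_add_le _ _).trans (by gcongr; exact abs_sum_map_le hterm _)
  have hpos : (0 : ℝ) < π.length := by exact_mod_cast List.length_pos_of_ne_nil hπ
  refine le_of_mul_le_mul_left ?_ hpos
  rw [mul_add, length_mul_calError, length_mul_calError]
  refine (Finset.sum_le_sum fun k _ => hbucket k).trans_eq ?_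
  rw [Finset.sum_add_distrib, ← Finset.sum_mul, ← Nat.cast_sum, sum_length_filter (b := Round.p)]

theorem calError_le {π : History X m} (hπ : π ≠ []) {h : X → ℝ} {B : ℝ} (hB : ∀ x, |h x| ≤ B) :
    calError π h ≤ B := by
  simpa [calError] using calError_le_add hπ (g := 0) (by simpa using hB)

variable {H : Set (X → ℝ)}

theorem multicalError_nonneg (π : History X m) (H : Set (X → ℝ)) : 0 ≤ multicalError π H :=
  Real.iSup_nonneg fun _ => calError_nonneg _ _

theorem multicalError_le_add {ι : Type*} {g : ι → X → ℝ} {β c : ℝ} (hH : H.Nonempty)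
    (hcover : ∀ h ∈ H, ∃ i, ∀ x, |h x - g i x| ≤ β) {π : History X m} (hπ : π ≠ [])
    (hc : ∀ i, calError π (g i) ≤ c) : multicalError π H ≤ c + β := by
  have := hH.to_subtype
  refine ciSup_le fun h => ?_
  obtain ⟨i, hi⟩ := hcover h h.2
  exact (calError_le_add hπ hi).trans (by gcongr; exact hc i)

end CalibrationError

section Gain

variable {X : Type*} {m : ℕ} {η B : ℝ} {h : X → ℝ}

/-- The return, on a bet of one unit, of the gambler who tests the calibration of the forecasts
against `h`; the learning rate `η` keeps it small. -/
noncomputable def gain (η : ℝ) (h : X → ℝ) (r : Round X m) : ℝ := η * (h r.x * r.residual)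

theorem abs_gain_le (hη : 0 ≤ η) (hB : ∀ x, |h x| ≤ B) (r : Round X m) :
    |gain η h r| ≤ η * B := by
  rw [gain, abs_mul, abs_mul, abs_of_nonneg hη]
  gcongr
  exact (mul_le_of_le_one_right (abs_nonneg _) r.abs_residual_le_one).trans (hB r.x)

theorem abs_gain_lt_one (hη : 0 ≤ η) (hB : ∀ x, |h x| ≤ B) (hηB : η * B < 1) (r : Round X m) :
    |gain η h r| < 1 :=
  (abs_gain_le hη hB r).trans_lt hηB

theorem mul_length_mul_calError_le (hη : 0 ≤ η) (hB : ∀ x, |h x| ≤ B) (hηB : η * B ≤ 1 / 2)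
    (π : History X m) :
    η * (π.length * calError π h) ≤ Real.log (potential Round.p (gain η h) π) +
      (m + 1) * Real.log 2 + π.length * (2 * (η * B) ^ 2) := by
  have hbucket (l : History X m) :
      |(l.map (gain η h)).sum| = η * |(l.map fun r => h r.x * r.residual).sum| := by
    rw [show gain η h = fun r : Round X m => η * (h r.x * r.residual) from rfl,
      List.sum_map_mul_left, abs_mul, abs_of_nonneg hη]
  have := sum_abs_sum_le_log_potential (b := Round.p) hηB (abs_gain_le hη hB) π
  simpa only [hbucket, ← Finset.mul_sum, ← length_mul_calError, Fintype.card_fin, Nat.cast_add,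
    Nat.cast_one] using this

end Gain

/-- A distribution `w` of the forecast `j / m` for which the expectation of `(y - j / m) * F j` is
at most `max |F| / m`, whatever the label `y`. -/
structure IsBalanced (m : ℕ) (F w : Fin (m + 1) → ℝ) : Prop where
  mem_stdSimplex : w ∈ stdSimplex ℝ (Fin (m + 1))
  sum_le : ∀ (y : unitInterval) (M : ℝ), (∀ j, |F j| ≤ M) →
    ∑ j, w j * ((y - (j : ℕ) / m) * F j) ≤ M / m

namespace IsBalanced

theorem single {m : ℕ} {F : Fin (m + 1) → ℝ} {j : Fin (m + 1)}
    (hj : ∀ y : unitInterval, (y - ((j : ℕ) : ℝ) / m) * F j ≤ 0) :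
    IsBalanced m F (Pi.single j 1) where
  mem_stdSimplex := single_mem_stdSimplex ℝ j
  sum_le y M hM := by
    have hM0 : 0 ≤ M := (abs_nonneg _).trans (hM j)
    have : 0 ≤ M / m := by positivity
    simpa [Pi.single_apply] using (hj y).trans this

theorem single_zero {m : ℕ} {F : Fin (m + 1) → ℝ} (hF : F 0 ≤ 0) :
    IsBalanced m F (Pi.single 0 1) :=
  single fun y => mul_nonpos_of_nonneg_of_nonpos (by simpa using y.2.1) hF

theorem single_last {m : ℕ} {F : Fin (m + 1) → ℝ} (hm : 0 < m) (hF : 0 ≤ F (Fin.last m)) :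
    IsBalanced m F (Pi.single (Fin.last m) 1) :=
  single fun y => mul_nonpos_of_nonpos_of_nonneg (by simpa [hm.ne'] using y.2.2) hF

-- The weights make `∑ j, w j * F j` vanish, so that only the spacing `1 / m` of the forecasts
-- contributes to the sum.
theorem pair {m : ℕ} {F : Fin (m + 1) → ℝ} {k : Fin m} (hpos : 0 < F k.castSucc)
    (hneg : F k.succ ≤ 0) :
    IsBalanced m F
      ((-F k.succ / (F k.castSucc - F k.succ)) • Pi.single k.castSucc 1 +
        (F k.castSucc / (F k.castSucc - F k.succ)) • Pi.single k.succ 1) where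
  mem_stdSimplex := by
    have hd : 0 < F k.castSucc - F k.succ := by linarith
    refine convex_stdSimplex ℝ _ (single_mem_stdSimplex ℝ _) (single_mem_stdSimplex ℝ _)
      (div_nonneg (neg_nonneg.2 hneg) hd.le) (div_nonneg hpos.le hd.le) ?_
    rw [← add_div, neg_add_eq_sub, div_self hd.ne']
  sum_le y M hM := by
    have hd : 0 < F k.castSucc - F k.succ := by linarith
    have hm : (0 : ℝ) < m := by exact_mod_cast k.pos
    have hweight : -F k.succ / (F k.castSucc - F k.succ) ≤ 1 := (div_le_one hd).2 (by linarith)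
    have hsum (G : Fin (m + 1) → ℝ) (a b : ℝ) :
        ∑ j, (a • Pi.single k.castSucc 1 + b • Pi.single k.succ 1 : Fin (m + 1) → ℝ) j * G j =
          a * G k.castSucc + b * G k.succ := by
      simp [add_mul, Finset.sum_add_distrib, Pi.single_apply]
    rw [hsum]
    calc _ = F k.castSucc / m * (-F k.succ / (F k.castSucc - F k.succ)) := by
          simp only [Fin.val_castSucc, Fin.val_succ, Nat.cast_add, Nat.cast_one]
          field_simp
          ring
      _ ≤ F k.castSucc / m * 1 := by gcongr
      _ ≤ M / m := by rw [mul_one]; gcongr; exact (le_abs_self _).trans (hM _)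

end IsBalanced

section Score

variable {X ι : Type*} [Fintype ι] {m : ℕ} {η B : ℝ} {g : ι → X → ℝ}

/-- The sum of the potentials of all the gamblers, one for each of the functions `g i`. -/
noncomputable def totalPotential (η : ℝ) (g : ι → X → ℝ) (π : History X m) : ℝ :=
  ∑ i, potential Round.p (gain η (g i)) π

/-- The rate at which the total potential grows with the residual of a round with context `x` and
forecast `j`, up to the factor `η`. -/
noncomputable def score (η : ℝ) (g : ι → X → ℝ) (π : History X m) (x : X) (j : Fin (m + 1)) : ℝ :=
  ∑ i, potential Round.p (gain η (g i)) π * g i x * stake Round.p (gain η (g i)) π j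

theorem totalPotential_pos [Nonempty ι] (hη : 0 ≤ η) (hg : ∀ i x, |g i x| ≤ B) (hηB : η * B < 1)
    (π : History X m) : 0 < totalPotential η g π :=
  Finset.sum_pos (fun i _ => potential_pos (abs_gain_lt_one hη (hg i) hηB) π)
    Finset.univ_nonempty

theorem totalPotential_cons (hη : 0 ≤ η) (hg : ∀ i x, |g i x| ≤ B) (hηB : η * B < 1)
    (r : Round X m) (π : History X m) :
    totalPotential η g (r :: π) =
      totalPotential η g π + η * r.residual * score η g π r.x r.p := by
  simp only [totalPotential, score, potential_cons (abs_gain_lt_one hη (hg _) hηB), mul_add,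
    mul_one, Finset.sum_add_distrib, Finset.mul_sum]
  congr 1
  exact Finset.sum_congr rfl fun i _ => by rw [gain]; ring

theorem abs_score_le (hη : 0 ≤ η) (hg : ∀ i x, |g i x| ≤ B) (hηB : η * B < 1)
    (π : History X m) (x : X) (j : Fin (m + 1)) :
    |score η g π x j| ≤ B * totalPotential η g π := by
  rw [totalPotential, Finset.mul_sum]
  refine (Finset.abs_sum_le_sum_abs _ _).trans (Finset.sum_le_sum fun i _ => ?_)
  have hgain := abs_gain_lt_one (m := m) hη (hg i) hηB
  have hpot := potential_pos (b := Round.p) hgain π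
  rw [abs_mul, abs_mul, abs_of_pos hpot, mul_comm B]
  calc _ ≤ potential Round.p (gain η (g i)) π * |g i x| * 1 := by
        gcongr
        exact (abs_stake_lt_one hgain π j).le
    _ ≤ _ := by rw [mul_one]; gcongr; exact hg i x

theorem sum_mul_totalPotential_cons_le (hη : 0 ≤ η) (hg : ∀ i x, |g i x| ≤ B) (hηB : η * B < 1)
    {π : History X m} {x : X} {w : Fin (m + 1) → ℝ} (hw : IsBalanced m (score η g π x) w)
    (y : unitInterval) :
    ∑ j, w j * totalPotential η g (⟨x, y, j⟩ :: π) ≤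
      (1 + η * B / m) * totalPotential η g π := by
  have hbalanced := hw.sum_le y _ (abs_score_le hη hg hηB π x)
  calc ∑ j, w j * totalPotential η g (⟨x, y, j⟩ :: π)
      = (∑ j, w j) * totalPotential η g π +
          η * ∑ j, w j * ((y - (j : ℕ) / m) * score η g π x j) := by
        simp only [totalPotential_cons hη hg hηB, Round.residual, mul_add,
          Finset.sum_add_distrib, Finset.sum_mul, Finset.mul_sum, mul_assoc, mul_left_comm η]
    _ ≤ 1 * totalPotential η g π + η * (B * totalPotential η g π / m) := by
        rw [hw.mem_stdSimplex.2]
        gcongr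
    _ = (1 + η * B / m) * totalPotential η g π := by ring

end Score

section RegretBound

variable {X ι : Type*} [Fintype ι] {m : ℕ} {η B : ℝ} {g : ι → X → ℝ}

theorem calError_le_log_totalPotential (hη : 0 < η) (hg : ∀ i x, |g i x| ≤ B)
    (hηB : η * B ≤ 1 / 2) {π : History X m} (hπ : π ≠ []) (i : ι) :
    calError π (g i) ≤ (η * π.length)⁻¹ * (Real.log (totalPotential η g π) +
      ((m + 1) * Real.log 2 + π.length * (2 * (η * B) ^ 2))) := by
  have hgain (i : ι) := abs_gain_lt_one (m := m) hη.le (hg i) (hηB.trans_lt one_half_lt_one)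
  have hlength : (0 : ℝ) < π.length := by exact_mod_cast List.length_pos_of_ne_nil hπ
  have hsingle : potential Round.p (gain η (g i)) π ≤ totalPotential η g π :=
    Finset.single_le_sum (f := fun i => potential Round.p (gain η (g i)) π)
      (fun i _ => (potential_pos (hgain i) π).le) (Finset.mem_univ i)
  have hlog := Real.log_le_log (potential_pos (hgain i) π) hsingle
  rw [le_inv_mul_iff₀ (by positivity), mul_assoc]
  linarith [mul_length_mul_calError_le hη.le (hg i) hηB π]

variable [Nonempty ι] {w : History X m → X → Fin (m + 1) → ℝ} {H : Set (X → ℝ)} {β : ℝ} {T : ℕ}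

theorem expectedValue_log_totalPotential_le (hη : 0 ≤ η) (hg : ∀ i x, |g i x| ≤ B)
    (hηB : η * B < 1) (hw : ∀ π x, IsBalanced m (score η g π x) (w π x)) (A : Adversary X m)
    (n : ℕ) :
    expectedValue w A (fun π => Real.log (totalPotential η g π)) n [] ≤
      Real.log (Fintype.card ι) + n * (η * B / m) := by
  have hcard : (0 : ℝ) < Fintype.card ι := by exact_mod_cast Fintype.card_pos
  have hB : 0 ≤ B := (abs_nonneg _).trans (hg (Classical.arbitrary ι) (A []).1)
  have hρ : 0 < 1 + η * B / m := by positivity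
  have hgrowth : expectedValue w A (totalPotential η g) n [] ≤
      (1 + η * B / m) ^ n * Fintype.card ι := by
    simpa [totalPotential] using
      expectedValue_le_pow_mul (A := A) (fun π x => (hw π x).mem_stdSimplex.1) hρ.le
        (fun π x y => sum_mul_totalPotential_cons_le hη hg hηB (hw π x) y) n []
  calc _ ≤ Real.log ((1 + η * B / m) ^ n * Fintype.card ι) :=
        expectedValue_log_le (fun π x => (hw π x).mem_stdSimplex)
          (totalPotential_pos hη hg hηB) (by positivity) hgrowth
    _ = Real.log (Fintype.card ι) + n * Real.log (1 + η * B / m) := by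
        rw [Real.log_mul (by positivity) hcard.ne', Real.log_pow, add_comm]
    _ ≤ _ := by
        gcongr
        linarith [Real.log_le_sub_one_of_pos hρ]

theorem expectedValue_multicalError_le (hη : 0 < η) (hg : ∀ i x, |g i x| ≤ B)
    (hηB : η * B ≤ 1 / 2) (hw : ∀ π x, IsBalanced m (score η g π x) (w π x)) (hH : H.Nonempty)
    (hcover : ∀ h ∈ H, ∃ i, ∀ x, |h x - g i x| ≤ β) (hT : 1 ≤ T) (A : Adversary X m) :
    expectedValue w A (fun π => multicalError π H) T [] ≤
      (η * T)⁻¹ * (Real.log (Fintype.card ι) + T * (η * B / m) +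
        ((m + 1) * Real.log 2 + T * (2 * (η * B) ^ 2))) + β := by
  set D := (m + 1) * Real.log 2 + T * (2 * (η * B) ^ 2) with hD
  have hpointwise (π : History X m) (hπ : π.length = ([] : History X m).length + T) :
      multicalError π H ≤
        (η * T)⁻¹ * Real.log (totalPotential η g π) + ((η * T)⁻¹ * D + β) := by
    have hlength : π.length = T := by simpa using hπ
    have hne : π ≠ [] := List.ne_nil_of_length_pos (by omega)
    rw [← add_assoc, ← mul_add, hD, ← hlength]
    exact multicalError_le_add hH hcover hne (calError_le_log_totalPotential hη hg hηB hne)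
  have hlog := expectedValue_log_totalPotential_le hη.le hg (hηB.trans_lt one_half_lt_one) hw A T
  calc _ ≤ (η * T)⁻¹ * expectedValue w A (fun π => Real.log (totalPotential η g π)) T [] +
          ((η * T)⁻¹ * D + β) :=
        (expectedValue_mono (fun π x => (hw π x).mem_stdSimplex.1) hpointwise).trans_eq
          (expectedValue_mul_add (fun π x => (hw π x).mem_stdSimplex.2) _ _ _ T [])
    _ ≤ (η * T)⁻¹ * (Real.log (Fintype.card ι) + T * (η * B / m)) + ((η * T)⁻¹ * D + β) := by
        gcongr
    _ = _ := by ring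

end RegretBound

theorem natCast_le_rpow_one_third {m T : ℕ} (h : m ^ 3 ≤ T) : (m : ℝ) ≤ (T : ℝ) ^ (1 / 3 : ℝ) := by
  rw [one_div, Real.le_rpow_inv_iff_of_pos m.cast_nonneg T.cast_nonneg three_pos]
  exact_mod_cast h

theorem rpow_one_third_lt_natCast {m T : ℕ} (h : T < m ^ 3) : (T : ℝ) ^ (1 / 3 : ℝ) < m := by
  rw [one_div, Real.rpow_inv_lt_iff_of_pos T.cast_nonneg m.cast_nonneg three_pos]
  exact_mod_cast h

theorem one_le_sqrt_log_six_mul {x : ℝ} (hx : 1 ≤ x) : 1 ≤ √(Real.log (6 * x)) := by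
  rw [Real.one_le_sqrt, Real.le_log_iff_exp_le (by positivity)]
  linarith [Real.exp_one_lt_d9]

theorem two_mul_div_cube_mul_le {a s m ℓ : ℝ} (hm : 1 ≤ m) (hma : m ≤ a) (ham : a ≤ 2 * m)
    (hs : 1 ≤ s) (hsa : s ≤ a) (hℓ : ℓ ≤ s ^ 2) :
    2 * m / a ^ 3 * (ℓ + (m + 1) * Real.log 2 + a ^ 3 / m ^ 2) ≤ 10 * (s / a) := by
  have ha : 0 < a := by linarith
  have hcover : 2 * m / a ^ 3 * ℓ ≤ 2 * (s / a) :=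
    calc 2 * m / a ^ 3 * ℓ ≤ 2 * m / a ^ 3 * (s * a) := by
          gcongr
          exact hℓ.trans (by rw [pow_two]; gcongr)
      _ ≤ 2 * a / a ^ 3 * (s * a) := by gcongr
      _ = 2 * (s / a) := by field_simp
  have hsigns : 2 * m / a ^ 3 * ((m + 1) * Real.log 2) ≤ 4 * (s / a) :=
    calc 2 * m / a ^ 3 * ((m + 1) * Real.log 2) ≤ 2 * a / a ^ 3 * ((a + a) * s) := by
          have : Real.log 2 ≤ s := by linarith [Real.log_two_lt_d9]
          gcongr
          exact hm.trans hma
      _ = 4 * (s / a) := by field_simp; ring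
  have hspacing : 2 * m / a ^ 3 * (a ^ 3 / m ^ 2) ≤ 4 * (s / a) :=
    calc 2 * m / a ^ 3 * (a ^ 3 / m ^ 2) = 4 * (1 / (2 * m)) := by field_simp; ring
      _ ≤ 4 * (s / a) := by gcongr
  linarith

theorem two_mul_div_mul_le_rate {m T N : ℕ} (hm : 0 < m) (hmT : m ^ 3 ≤ T)
    (hTm : T < (m + 1) ^ 3) (hN : 0 < N)
    (hsmall : √(Real.log (6 * T * N)) ≤ (T : ℝ) ^ (1 / 3 : ℝ)) :
    2 * m / T * (Real.log N + (m + 1) * Real.log 2 + T / m ^ 2) ≤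
      10 * ((T : ℝ) ^ (-(1 / 3) : ℝ) * √(Real.log (6 * T * N))) := by
  have hm1 : (1 : ℝ) ≤ m := by exact_mod_cast hm
  have hN1 : (1 : ℝ) ≤ N := by exact_mod_cast hN
  have hT1 : (1 : ℝ) ≤ T := by exact_mod_cast (Nat.one_le_pow 3 m hm).trans hmT
  have hma := natCast_le_rpow_one_third hmT
  have ham := rpow_one_third_lt_natCast hTm
  have hcube : ((T : ℝ) ^ (1 / 3 : ℝ)) ^ 3 = T := by
    rw [← Real.rpow_mul_natCast T.cast_nonneg]
    norm_num
  have hs : 1 ≤ √(Real.log (6 * T * N)) := by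
    rw [mul_assoc]
    exact one_le_sqrt_log_six_mul (one_le_mul_of_one_le_of_one_le hT1 hN1)
  have hlogN : Real.log N ≤ √(Real.log (6 * T * N)) ^ 2 := by
    rw [Real.sq_sqrt (Real.one_le_sqrt.1 hs |>.trans' zero_le_one)]
    exact Real.log_le_log (by linarith) (le_mul_of_one_le_left (by linarith) (by linarith))
  rw [Nat.cast_succ] at ham
  have hrate := two_mul_div_cube_mul_le hm1 hma (by linarith) hs hsmall hlogN
  rwa [hcube, div_eq_inv_mul √_, ← Real.rpow_neg T.cast_nonneg] at hrate

section Rate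

variable {X ι : Type*} [Fintype ι] [Nonempty ι] {m T : ℕ} {B β : ℝ} {g : ι → X → ℝ}
  {w : History X m → X → Fin (m + 1) → ℝ} {H : Set (X → ℝ)}

/-- The learning rate of the algorithm, for which the gains are at most `1 / (2 m)`. It is `0` when
`B = 0`, where all the gains vanish anyway. -/
noncomputable def learningRate (B : ℝ) (m : ℕ) : ℝ := (2 * B * m)⁻¹

theorem learningRate_nonneg (hB : 0 ≤ B) (m : ℕ) : 0 ≤ learningRate B m := by
  rw [learningRate]
  positivity

theorem learningRate_mul_le_half (B : ℝ) (m : ℕ) : learningRate B m * B ≤ 1 / 2 := by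
  rcases eq_or_ne B 0 with rfl | hB
  · simp
  · have hrate : learningRate B m * B = (2 : ℝ)⁻¹ * (m : ℝ)⁻¹ := by
      rw [learningRate, mul_inv, mul_inv]
      field_simp
    rw [hrate, one_div]
    exact mul_le_of_le_one_right (by norm_num) m.cast_inv_le_one

theorem expectedValue_multicalError_nonneg (hw : ∀ π x, w π x ∈ stdSimplex ℝ (Fin (m + 1)))
    (A : Adversary X m) (n : ℕ) :
    0 ≤ expectedValue w A (fun π => multicalError π H) n [] :=
  (expectedValue_const (fun π x => (hw π x).2) 0 n []).symm.trans_le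
    (expectedValue_mono (fun π x => (hw π x).1) fun π _ => multicalError_nonneg π H)

theorem expectedValue_multicalError_le_add {ι : Type*} {g : ι → X → ℝ} (hg : ∀ i x, |g i x| ≤ B)
    (hw : ∀ π x, w π x ∈ stdSimplex ℝ (Fin (m + 1))) (hH : H.Nonempty)
    (hcover : ∀ h ∈ H, ∃ i, ∀ x, |h x - g i x| ≤ β) (hT : 1 ≤ T) (A : Adversary X m) :
    expectedValue w A (fun π => multicalError π H) T [] ≤ B + β := by
  refine (expectedValue_mono (fun π x => (hw π x).1) fun π hπ => ?_).trans_eq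
    (expectedValue_const (fun π x => (hw π x).2) (B + β) T [])
  have hne : π ≠ [] := List.ne_nil_of_length_pos (by rw [hπ, List.length_nil]; omega)
  exact multicalError_le_add hH hcover hne fun i => calError_le hne (hg i)

theorem expectedValue_multicalError_le_of_learningRate (hm : 0 < m) (hB : 0 < B)
    (hg : ∀ i x, |g i x| ≤ B)
    (hw : ∀ π x, IsBalanced m (score (learningRate B m) g π x) (w π x)) (hH : H.Nonempty)
    (hcover : ∀ h ∈ H, ∃ i, ∀ x, |h x - g i x| ≤ β) (hT : 1 ≤ T) (A : Adversary X m) :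
    expectedValue w A (fun π => multicalError π H) T [] ≤
      B * (2 * m / T * (Real.log (Fintype.card ι) + (m + 1) * Real.log 2 + T / m ^ 2)) + β := by
  have : (0 : ℝ) < T := by exact_mod_cast hT
  have : (0 : ℝ) < m := by exact_mod_cast hm
  have hrate : learningRate B m * B = 1 / (2 * m) := by
    rw [learningRate]
    field_simp
  have hpos : 0 < learningRate B m := by rw [learningRate]; positivity
  refine (expectedValue_multicalError_le hpos hg (learningRate_mul_le_half B m)
    hw hH hcover hT A).trans_eq ?_
  rw [hrate, learningRate]
  field_simp
  ring

theorem expectedValue_multicalError_le_rate (hm : 0 < m) (hmT : m ^ 3 ≤ T) (hTm : T < (m + 1) ^ 3)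
    (hg : ∀ i x, |g i x| ≤ B)
    (hw : ∀ π x, IsBalanced m (score (learningRate B m) g π x) (w π x)) (hH : H.Nonempty)
    (hcover : ∀ h ∈ H, ∃ i, ∀ x, |h x - g i x| ≤ β) (A : Adversary X m) :
    expectedValue w A (fun π => multicalError π H) T [] ≤
      10 * (B * (T : ℝ) ^ (-(1 / 3) : ℝ) * √(Real.log (6 * T * Fintype.card ι))) + β := by
  have hT : 1 ≤ T := (Nat.one_le_pow 3 m hm).trans hmT
  have hB : 0 ≤ B := (abs_nonneg _).trans (hg (Classical.arbitrary ι) (A []).1)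
  have htrivial := expectedValue_multicalError_le_add hg (fun π x => (hw π x).mem_stdSimplex) hH
    hcover hT A
  rcases hB.eq_or_lt with rfl | hBpos
  · simpa using htrivial
  rcases le_total √(Real.log (6 * T * Fintype.card ι)) ((T : ℝ) ^ (1 / 3 : ℝ)) with hsmall | hlarge
  · refine (expectedValue_multicalError_le_of_learningRate hm hBpos hg hw hH hcover hT A).trans ?_
    rw [mul_assoc B, mul_left_comm 10]
    gcongr B * ?_ + β
    exact two_mul_div_mul_le_rate hm hmT hTm Fintype.card_pos hsmall
  · have hTpos : (0 : ℝ) < (T : ℝ) ^ (1 / 3 : ℝ) := by positivity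
    have hratio : 1 ≤ (T : ℝ) ^ (-(1 / 3) : ℝ) * √(Real.log (6 * T * Fintype.card ι)) := by
      rwa [Real.rpow_neg T.cast_nonneg, inv_mul_eq_div, one_le_div hTpos]
    rw [mul_assoc B]
    nlinarith

end Rate

end Multicalibration

/-! ## Program logic for the real RAM -/

namespace RealRAM

namespace State

@[simp]
theorem setNat_nat (s : State) (r n r' : ℕ) :
    (s.setNat r n).nat r' = if r' = r then n else s.nat r' := rfl

@[simp]
theorem setNat_arr (s : State) (r n : ℕ) : (s.setNat r n).arr = s.arr := rfl

@[simp]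
theorem setArr_nat (s : State) (a i j : ℕ) (v : ℝ) : (s.setArr a i j v).nat = s.nat := rfl

@[simp]
theorem setArr_arr (s : State) (a i j : ℕ) (v : ℝ) (a' i' j' : ℕ) :
    (s.setArr a i j v).arr a' i' j' =
      if a' = a ∧ i' = i ∧ j' = j then v else s.arr a' i' j' := rfl

end State

namespace Prog

/-- The registers that a program may write. -/
def regs : Prog → Finset ℕ
  | skip => ∅
  | setNat r _ => {r}
  | setArr _ _ _ _ => ∅
  | seq p₁ p₂ => p₁.regs ∪ p₂.regs
  | iteNat _ _ p₁ p₂ => p₁.regs ∪ p₂.regs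
  | iteReal _ _ p₁ p₂ => p₁.regs ∪ p₂.regs
  | loop _ p => p.regs

/-- The arrays that a program may write. -/
def arrays : Prog → Finset ℕ
  | skip => ∅
  | setNat _ _ => ∅
  | setArr a _ _ _ => {a}
  | seq p₁ p₂ => p₁.arrays ∪ p₂.arrays
  | iteNat _ _ p₁ p₂ => p₁.arrays ∪ p₂.arrays
  | iteReal _ _ p₁ p₂ => p₁.arrays ∪ p₂.arrays
  | loop _ p => p.arrays

theorem exec_nat_of_notMem_regs (orc : ℕ → ℝ) {r : ℕ} :
    ∀ {p : Prog}, r ∉ p.regs → ∀ s, (p.exec orc s).nat r = s.nat r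
  | skip, _, _ => rfl
  | setNat _ _, h, s => if_neg (by simpa only [regs, Finset.mem_singleton] using h)
  | setArr _ _ _ _, _, _ => rfl
  | seq p₁ p₂, h, s => by
    simp only [regs, Finset.notMem_union] at h
    exact (exec_nat_of_notMem_regs orc h.2 _).trans (exec_nat_of_notMem_regs orc h.1 s)
  | iteNat _ _ p₁ p₂, h, s | iteReal _ _ p₁ p₂, h, s => by
    simp only [regs, Finset.notMem_union] at h
    rw [exec]
    split_ifs
    exacts [exec_nat_of_notMem_regs orc h.1 s, exec_nat_of_notMem_regs orc h.2 s]
  | loop e p, h, s => by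
    rw [exec]
    exact Function.Iterate.rec (fun s' : State => s'.nat r = s.nat r) rfl
      (fun s' hs' => (exec_nat_of_notMem_regs orc (p := p) h s').trans hs') (e.eval s)

theorem exec_arr_of_notMem_arrays (orc : ℕ → ℝ) {a : ℕ} :
    ∀ {p : Prog}, a ∉ p.arrays → ∀ s, (p.exec orc s).arr a = s.arr a
  | skip, _, _ => rfl
  | setNat _ _, _, _ => rfl
  | setArr _ _ _ _, h, s => by
    funext i j
    exact if_neg fun hc => h (by simp only [arrays, Finset.mem_singleton, hc.1])
  | seq p₁ p₂, h, s => by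
    simp only [arrays, Finset.notMem_union] at h
    exact (exec_arr_of_notMem_arrays orc h.2 _).trans (exec_arr_of_notMem_arrays orc h.1 s)
  | iteNat _ _ p₁ p₂, h, s | iteReal _ _ p₁ p₂, h, s => by
    simp only [arrays, Finset.notMem_union] at h
    rw [exec]
    split_ifs
    exacts [exec_arr_of_notMem_arrays orc h.1 s, exec_arr_of_notMem_arrays orc h.2 s]
  | loop e p, h, s => by
    rw [exec]
    exact Function.Iterate.rec (fun s' : State => s'.arr a = s.arr a) rfl
      (fun s' hs' => (exec_arr_of_notMem_arrays orc (p := p) h s').trans hs') (e.eval s)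

/-- The states `s` and `s'` differ only in registers and arrays that `p` may write. -/
structure Frame (p : Prog) (s s' : State) : Prop where
  nat_eq : ∀ r ∉ p.regs, s'.nat r = s.nat r
  arr_eq : ∀ a ∉ p.arrays, s'.arr a = s.arr a

theorem frame_exec (p : Prog) (orc : ℕ → ℝ) (s : State) : p.Frame s (p.exec orc s) :=
  ⟨fun _ h => exec_nat_of_notMem_regs orc h s, fun _ h => exec_arr_of_notMem_arrays orc h s⟩

/-- Total correctness with a time bound: run from memory `s`, the program `p` takes at most `c`
steps and ends in a memory that satisfies `Q`. -/
structure Ensures (orc : ℕ → ℝ) (p : Prog) (s : State) (c : ℕ) (Q : State → Prop) : Prop where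
  post : Q (p.exec orc s)
  time_le : p.time orc s ≤ c

variable {orc : ℕ → ℝ} {p p₁ p₂ : Prog} {s : State} {c c₁ c₂ : ℕ}
  {Q R : State → Prop}

theorem Ensures.mono (h : p.Ensures orc s c₁ Q) (hc : c₁ ≤ c₂)
    (hQ : ∀ s', p.Frame s s' → Q s' → R s') : p.Ensures orc s c₂ R :=
  ⟨hQ _ (p.frame_exec orc s) h.post, h.time_le.trans hc⟩

theorem Ensures.seq (h₁ : p₁.Ensures orc s c₁ Q)
    (h₂ : ∀ s', p₁.Frame s s' → Q s' → p₂.Ensures orc s' c₂ R) (hc : c₁ + c₂ ≤ c) :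
    (p₁.seq p₂).Ensures orc s c R :=
  have h := h₂ _ (p₁.frame_exec orc s) h₁.post
  ⟨h.post, (Nat.add_le_add h₁.time_le h.time_le).trans hc⟩

theorem Ensures.setNat_seq {r : ℕ} {e : NExpr} (h : p.Ensures orc (s.setNat r (e.eval s)) c₁ Q)
    (hc : e.size + 1 + c₁ ≤ c) : ((setNat r e).seq p).Ensures orc s c Q :=
  ⟨h.post, (Nat.add_le_add_left h.time_le _).trans hc⟩

theorem Ensures.setArr_seq {a : ℕ} {i j : NExpr} {e : RExpr}
    (h : p.Ensures orc (s.setArr a (i.eval s) (j.eval s) (e.eval orc s)) c₁ Q)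
    (hc : i.size + j.size + e.size + 1 + c₁ ≤ c) : ((setArr a i j e).seq p).Ensures orc s c Q :=
  ⟨h.post, (Nat.add_le_add_left h.time_le _).trans hc⟩

theorem ensures_loop {e : NExpr} {n : ℕ} (I : ℕ → State → Prop) (hn : e.eval s = n) (h0 : I 0 s)
    (hstep : ∀ k < n, ∀ s', p.Frame s s' → I k s' → p.Ensures orc s' c (I (k + 1))) :
    (loop e p).Ensures orc s (e.size + 1 + n * (1 + c)) (I n) := by
  have frame_iterate (k : ℕ) : p.Frame s ((p.exec orc)^[k] s) :=
    have h := (loop (.lit k) p).frame_exec orc s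
    ⟨h.nat_eq, h.arr_eq⟩
  have invariant : ∀ k ≤ n, I k ((p.exec orc)^[k] s) := fun k hk => by
    induction k with
    | zero => exact h0
    | succ k ih =>
      rw [Function.iterate_succ_apply']
      exact (hstep k hk _ (frame_iterate k) (ih (Nat.le_of_lt hk))).post
  refine ⟨by simpa only [exec, hn] using invariant n le_rfl, ?_⟩
  rw [time, hn]
  gcongr
  refine (Finset.sum_le_card_nsmul _ _ (1 + c) fun k hk => ?_).trans_eq (by simp)
  have hk := Finset.mem_range.1 hk
  exact Nat.add_le_add_left (hstep k hk _ (frame_iterate k) (invariant k hk.le)).time_le 1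

end Prog

end RealRAM

/-! ## The forecasting program -/

namespace Multicalibration

open RealRAM

section Programs

/-! Memory layout. Registers: the horizon (0), the number of functions (1), `m` (2), the forecast
index (3), the function counter (4), the forecast counter (5), the index of the sign change (6).
Arrays: the bound and the label (0), the weights (1), the stakes, indexed by function and forecast
(2), the potentials minus one, so that the initial memory is correct (3), the scores (4), the
current gain (5). -/

/-- Stores the integer cube root of the horizon in register 2. -/
def cubeRootProg : Prog :=
  .loop (.reg 0)
    (.iteReal
      (.mul (.mul (.ofIndex (.add (.reg 2) (.lit 1))) (.ofIndex (.add (.reg 2) (.lit 1))))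
        (.ofIndex (.add (.reg 2) (.lit 1))))
      (.ofIndex (.reg 0))
      (.setNat 2 (.add (.reg 2) (.lit 1)))
      .skip)

/-- Adds the contributions of all functions to the score of the forecast in register 5. -/
def addScoresProg : Prog :=
  .loop (.reg 1)
    (.seq
      (.setArr 4 (.lit 0) (.reg 5)
        (.add (.cell 4 (.lit 0) (.reg 5))
          (.mul (.mul (.add (.lit 1) (.cell 3 (.reg 4) (.lit 0))) (.query (.reg 4)))
            (.cell 2 (.reg 4) (.reg 5)))))
      (.setNat 4 (.add (.reg 4) (.lit 1))))

/-- Clears the weights and computes the scores of all forecasts. -/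
def scoreProg : Prog :=
  .seq (.setNat 5 (.lit 0))
    (.loop (.add (.reg 2) (.lit 1))
      (.seq (.setArr 1 (.lit 0) (.reg 5) (.lit 0))
        (.seq (.setArr 4 (.lit 0) (.reg 5) (.lit 0))
          (.seq (.setNat 4 (.lit 0))
            (.seq addScoresProg
              (.setNat 5 (.add (.reg 5) (.lit 1))))))))

/-- Stores in register 6 the index of the first non-positive score, or `m + 1`. -/
def signChangeProg : Prog :=
  .seq (.setNat 6 (.lit 0))
    (.loop (.add (.reg 2) (.lit 1))
      (.iteReal (.cell 4 (.lit 0) (.reg 6)) (.lit 0) .skip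
        (.setNat 6 (.add (.reg 6) (.lit 1)))))

/-- Writes balanced weights, given the scores and the index of their sign change. -/
def weightProg : Prog :=
  .iteNat (.reg 6) (.lit 0) (.setArr 1 (.lit 0) (.lit 0) (.lit 1))
    (.iteNat (.add (.reg 2) (.lit 1)) (.reg 6) (.setArr 1 (.lit 0) (.reg 2) (.lit 1))
      (.seq
        (.setArr 1 (.lit 0) (.reg 6)
          (.div (.cell 4 (.lit 0) (.sub (.reg 6) (.lit 1)))
            (.sub (.cell 4 (.lit 0) (.sub (.reg 6) (.lit 1))) (.cell 4 (.lit 0) (.reg 6)))))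
        (.setArr 1 (.lit 0) (.sub (.reg 6) (.lit 1))
          (.div (.sub (.lit 0) (.cell 4 (.lit 0) (.reg 6)))
            (.sub (.cell 4 (.lit 0) (.sub (.reg 6) (.lit 1))) (.cell 4 (.lit 0) (.reg 6)))))))

/-- Computes the forecast weights of a round. -/
def predictProg : Prog := .seq scoreProg (.seq signChangeProg weightProg)

/-- Updates the stakes and the potential of the function in register 4. -/
def updateBody : Prog :=
  .seq
    (.setArr 5 (.lit 0) (.lit 0)
      (.div
        (.mul (.query (.reg 4))
          (.sub (.cell 0 (.lit 0) (.lit 1)) (.div (.ofIndex (.reg 3)) (.ofIndex (.reg 2)))))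
        (.mul (.mul (.lit 2) (.cell 0 (.lit 0) (.lit 0))) (.ofIndex (.reg 2)))))
    (.seq
      (.setArr 3 (.reg 4) (.lit 0)
        (.add (.cell 3 (.reg 4) (.lit 0))
          (.mul (.add (.lit 1) (.cell 3 (.reg 4) (.lit 0)))
            (.mul (.cell 5 (.lit 0) (.lit 0)) (.cell 2 (.reg 4) (.reg 3))))))
      (.seq
        (.setArr 2 (.reg 4) (.reg 3)
          (.div (.add (.cell 2 (.reg 4) (.reg 3)) (.cell 5 (.lit 0) (.lit 0)))
            (.add (.lit 1)
              (.mul (.cell 5 (.lit 0) (.lit 0)) (.cell 2 (.reg 4) (.reg 3))))))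
        (.setNat 4 (.add (.reg 4) (.lit 1)))))

/-- Updates all stakes and potentials after the label is revealed. -/
def updateProg : Prog := .seq (.setNat 4 (.lit 0)) (.loop (.reg 1) updateBody)

/-- The algorithm that takes for `m` the integer cube root of the horizon and forecasts with
balanced weights for the scores. -/
def forecaster : Algorithm where
  init := cubeRootProg
  predict := predictProg
  update := updateProg

/-- The score of the `j`-th forecast that is computed from memory `s`. -/
noncomputable def storedScore (orc : ℕ → ℝ) (s : State) (n j : ℕ) : ℝ :=
  ∑ i ∈ Finset.range n, (1 + s.arr 3 i 0) * orc i * s.arr 2 i j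

/-- The gain of the `i`-th function that is computed from memory `s`. -/
noncomputable def storedGain (orc : ℕ → ℝ) (s : State) (i : ℕ) : ℝ :=
  orc i * (s.arr 0 0 1 - (s.nat 3 : ℝ) / (s.nat 2 : ℝ)) / (2 * s.arr 0 0 0 * (s.nat 2 : ℝ))

/-- In memory `s'`, the potential and the stakes of the `i`-th function that were stored in `s`
have been updated with its gain. -/
structure IsUpdated (orc : ℕ → ℝ) (s s' : State) (i : ℕ) : Prop where
  potential_eq : s'.arr 3 i 0 =
    s.arr 3 i 0 + (1 + s.arr 3 i 0) * (storedGain orc s i * s.arr 2 i (s.nat 3))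
  stake_eq : s'.arr 2 i = Function.update (s.arr 2 i) (s.nat 3)
    ((s.arr 2 i (s.nat 3) + storedGain orc s i) /
      (1 + storedGain orc s i * s.arr 2 i (s.nat 3)))

/-- `k` is the least index below `n` at which `F` is non-positive, or `n` if there is none. -/
structure IsSignChange (F : ℕ → ℝ) (n k : ℕ) : Prop where
  le : k ≤ n
  pos : ∀ i < k, 0 < F i
  nonpos : k < n → F k ≤ 0

variable (orc : ℕ → ℝ) (s : State)

theorem cubeRootProg_ensures (hs : s.nat 2 = 0) :
    cubeRootProg.Ensures orc s (2 + s.nat 0 * 25)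
      fun s' => s'.nat 2 ^ 3 ≤ s.nat 0 ∧ s.nat 0 < (s'.nat 2 + 1) ^ 3 := by
  refine Prog.Ensures.mono (Prog.ensures_loop (c := 24) (fun k s' => s'.nat 2 ^ 3 ≤ s.nat 0 ∧
    (s'.nat 2 = k ∨ s.nat 0 < (s'.nat 2 + 1) ^ 3)) rfl (by simp [hs]) ?_) le_rfl ?_
  · rintro k - s' hframe ⟨hle, hlt⟩
    have hreg : s'.nat 0 = s.nat 0 := hframe.nat_eq 0 (by decide)
    have hcube : ((s'.nat 2 + 1 : ℕ) : ℝ) * ((s'.nat 2 + 1 : ℕ) : ℝ) * ((s'.nat 2 + 1 : ℕ) : ℝ)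
        ≤ (s.nat 0 : ℝ) ↔ (s'.nat 2 + 1) ^ 3 ≤ s.nat 0 := by
      rw [← Nat.cast_mul, ← Nat.cast_mul, Nat.cast_le, pow_succ, pow_two]
    constructor
    · simp only [Prog.exec, RExpr.eval, NExpr.eval, hreg, hcube]
      split_ifs with hnext
      · exact ⟨hnext, Or.inl (by simp; omega)⟩
      · exact ⟨hle, Or.inr (not_le.1 hnext)⟩
    · simp only [Prog.time, RExpr.size, NExpr.size]
      split_ifs <;> norm_num
  · rintro s' - ⟨hle, hcount | hlt⟩
    · exact ⟨hle, hcount ▸ (Nat.lt_succ_self _).trans_le (Nat.le_self_pow (by norm_num) _)⟩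
    · exact ⟨hle, hlt⟩

theorem addScoresProg_ensures (hcount : s.nat 4 = 0) (hzero : s.arr 4 0 (s.nat 5) = 0) :
    addScoresProg.Ensures orc s (2 + s.nat 1 * 24) fun s' =>
      s'.arr 4 0 = Function.update (s.arr 4 0) (s.nat 5)
        (storedScore orc s (s.nat 1) (s.nat 5)) := by
  refine Prog.Ensures.mono (Prog.ensures_loop (c := 23) (fun k s' => s'.nat 4 = k ∧
    s'.arr 4 0 = Function.update (s.arr 4 0) (s.nat 5) (storedScore orc s k (s.nat 5)))
    rfl ⟨hcount, ?_⟩ ?_) le_rfl fun s' _ h => h.2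
  · simp [storedScore, ← hzero]
  · rintro k - s' hframe ⟨hk, hscore⟩
    refine ⟨⟨by simp [Prog.exec, NExpr.eval, hk], funext fun j => ?_⟩,
      by simp [Prog.time, RExpr.size, NExpr.size]⟩
    have hreg : s'.nat 5 = s.nat 5 := hframe.nat_eq 5 (by decide)
    have harr₂ : s'.arr 2 = s.arr 2 := hframe.arr_eq 2 (by decide)
    have harr₃ : s'.arr 3 = s.arr 3 := hframe.arr_eq 3 (by decide)
    by_cases hj : j = s.nat 5 <;>
      simp [Prog.exec, NExpr.eval, RExpr.eval, hreg, harr₂, harr₃, hk, hj, hscore, storedScore,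
        Finset.sum_range_succ]

theorem scoreProg_ensures :
    scoreProg.Ensures orc s (6 + (s.nat 2 + 1) * (18 + s.nat 1 * 24)) fun s' =>
      ∀ j ≤ s.nat 2, s'.arr 1 0 j = 0 ∧ s'.arr 4 0 j = storedScore orc s (s.nat 1) j := by
  refine Prog.Ensures.setNat_seq (Prog.Ensures.mono (Prog.ensures_loop (c := 17 + s.nat 1 * 24)
    (fun k s' => s'.nat 5 = k ∧ ∀ j < k, s'.arr 1 0 j = 0 ∧
      s'.arr 4 0 j = storedScore orc s (s.nat 1) j) (n := s.nat 2 + 1) rfl ⟨rfl, by simp⟩ ?_) le_rfl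
    fun s' _ h j hj => h.2 j (Nat.lt_succ_of_le hj))
    (by simp only [NExpr.size]; linarith)
  rintro k - s' hframe ⟨hk, hdone⟩
  have hreg : s'.nat 1 = s.nat 1 := hframe.nat_eq 1 (by decide)
  have harr₂ : s'.arr 2 = s.arr 2 := hframe.arr_eq 2 (by decide)
  have harr₃ : s'.arr 3 = s.arr 3 := hframe.arr_eq 3 (by decide)
  refine Prog.Ensures.setArr_seq (Prog.Ensures.setArr_seq (Prog.Ensures.setNat_seq
    (Prog.Ensures.seq (c₂ := 4) (addScoresProg_ensures orc _ rfl
      (by simp [NExpr.eval, RExpr.eval])) (fun s'' hframe' hscore => ⟨⟨?_, fun j hj => ?_⟩, ?_⟩)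
      le_rfl) le_rfl) le_rfl) ?_
  · have h5 := hframe'.nat_eq 5 (by decide)
    simp [Prog.exec, NExpr.eval, h5, hk]
  · have h1 := hframe'.arr_eq 1 (by decide)
    rcases Nat.lt_succ_iff_lt_or_eq.1 hj with hj | rfl
    · simp [Prog.exec, h1, hscore, NExpr.eval, hk, hj.ne, hdone j hj]
    · simp [Prog.exec, h1, hscore, NExpr.eval, RExpr.eval, hk, storedScore, hreg, harr₂, harr₃]
  · rfl
  · simp only [State.setNat_nat, State.setArr_nat, NExpr.size, RExpr.size, hreg, OfNat.one_ne_ofNat,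
      if_false]
    omega

theorem signChangeProg_ensures :
    signChangeProg.Ensures orc s (6 + (s.nat 2 + 1) * 10) fun s' =>
      IsSignChange (s.arr 4 0) (s.nat 2 + 1) (s'.nat 6) := by
  refine Prog.Ensures.setNat_seq (Prog.ensures_loop (c := 9)
    (fun k s' => IsSignChange (s.arr 4 0) k (s'.nat 6)) (n := s.nat 2 + 1) rfl
    ⟨le_rfl, by simp [NExpr.eval], by simp [NExpr.eval]⟩ ?_) (by simp only [NExpr.size]; linarith)
  rintro k - s' hframe ⟨hle, hpos, hnonpos⟩
  have harr : s'.arr 4 = s.arr 4 := hframe.arr_eq 4 (by decide)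
  constructor
  · simp only [Prog.exec, RExpr.eval, NExpr.eval, harr, Rat.cast_zero]
    split_ifs with hcur
    · exact ⟨by omega, hpos, fun _ => hcur⟩
    · obtain rfl : s'.nat 6 = k := hle.antisymm (not_lt.1 fun h => hcur (hnonpos h))
      simp only [State.setNat_nat, if_true]
      refine ⟨le_rfl, fun i hi => ?_, fun h => absurd h (lt_irrefl _)⟩
      rcases Nat.lt_succ_iff_lt_or_eq.1 hi with hi | rfl
      exacts [hpos i hi, not_le.1 hcur]
  · simp only [Prog.time, RExpr.size, NExpr.size]
    split_ifs <;> norm_num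

theorem weightProg_ensures {m : ℕ} (hm : 0 < m) (hreg : s.nat 2 = m)
    (hzero : ∀ j ≤ m, s.arr 1 0 j = 0) (hsign : IsSignChange (s.arr 4 0) (m + 1) (s.nat 6)) :
    weightProg.Ensures orc s 60 fun s' =>
      IsBalanced m (fun j => s.arr 4 0 j) (fun j => s'.arr 1 0 j) := by
  constructor
  · simp only [weightProg, Prog.exec, RExpr.eval, NExpr.eval, State.setArr_nat, hreg]
    have hzero' (j : Fin (m + 1)) : s.arr 1 0 j = 0 := hzero j (Nat.lt_succ_iff.1 j.2)
    split_ifs with hfirst hlast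
    · have h6 : s.nat 6 = 0 := Nat.le_zero.1 hfirst
      convert IsBalanced.single_zero (m := m) (F := fun j => s.arr 4 0 j)
        (by simpa [h6] using hsign.nonpos (by omega)) using 1
      funext j
      simp [hzero', Pi.single_apply]
    · convert IsBalanced.single_last (m := m) (F := fun j => s.arr 4 0 j) hm
        (hsign.pos _ (by simp; omega)).le using 1
      funext j
      simp only [State.setArr_arr, hzero', Pi.single_apply, Fin.ext_iff, Fin.val_last, true_and,
        Rat.cast_one]
    · obtain ⟨k, hk⟩ : ∃ k, s.nat 6 = k + 1 := Nat.exists_eq_succ_of_ne_zero (by omega)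
      convert IsBalanced.pair (m := m) (F := fun j => s.arr 4 0 j) (k := ⟨k, by omega⟩)
        (hsign.pos _ (by simp; omega)) (by simpa [hk] using hsign.nonpos (by omega)) using 1
      funext j
      by_cases hjk : (j : ℕ) = k <;>
        simp [hzero', hk, hjk, Pi.single_apply, Fin.ext_iff]
  · simp only [weightProg, Prog.time, RExpr.size, NExpr.size]
    split_ifs <;> norm_num

theorem predictProg_ensures {m : ℕ} (hm : 0 < m) (hreg : s.nat 2 = m) :
    predictProg.Ensures orc s (72 + (m + 1) * (28 + s.nat 1 * 24)) fun s' =>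
      IsBalanced m (fun j => storedScore orc s (s.nat 1) j) (fun j => s'.arr 1 0 j) := by
  refine Prog.Ensures.seq (scoreProg_ensures orc s) (fun s₁ hframe₁ hscore => ?_)
    (c₂ := 66 + (m + 1) * 10) (by rw [hreg]; linarith)
  have hreg₁ : s₁.nat 2 = m := (hframe₁.nat_eq 2 (by decide)).trans hreg
  refine Prog.Ensures.seq (signChangeProg_ensures orc s₁) (fun s₂ hframe₂ hsign => ?_)
    (c₂ := 60) (by rw [hreg₁]; linarith)
  have hreg₂ : s₂.nat 2 = m := (hframe₂.nat_eq 2 (by decide)).trans hreg₁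
  have harr₁ : s₂.arr 1 = s₁.arr 1 := hframe₂.arr_eq 1 (by decide)
  have harr₄ : s₂.arr 4 = s₁.arr 4 := hframe₂.arr_eq 4 (by decide)
  rw [hreg] at hscore
  rw [hreg₁] at hsign
  have hweight := weightProg_ensures orc s₂ hm hreg₂
    (fun j hj => by rw [harr₁, (hscore j hj).1]) (by rwa [harr₄])
  have hstored : (fun j : Fin (m + 1) => s₂.arr 4 0 j) =
      fun j : Fin (m + 1) => storedScore orc s (s.nat 1) j :=
    funext fun j => by rw [harr₄, (hscore j (Nat.lt_succ_iff.1 j.2)).2]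
  rwa [hstored] at hweight

theorem updateBody_exec :
    updateBody.exec orc s = (((s.setArr 5 0 0 (storedGain orc s (s.nat 4))).setArr 3 (s.nat 4) 0
      (s.arr 3 (s.nat 4) 0 + (1 + s.arr 3 (s.nat 4) 0) *
        (storedGain orc s (s.nat 4) * s.arr 2 (s.nat 4) (s.nat 3)))).setArr 2 (s.nat 4) (s.nat 3)
      ((s.arr 2 (s.nat 4) (s.nat 3) + storedGain orc s (s.nat 4)) /
        (1 + storedGain orc s (s.nat 4) * s.arr 2 (s.nat 4) (s.nat 3)))).setNat 4
      (s.nat 4 + 1) := by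
  simp [updateBody, Prog.exec, RExpr.eval, NExpr.eval, storedGain]

theorem updateProg_ensures :
    updateProg.Ensures orc s (4 + s.nat 1 * 80) fun s' => ∀ i < s.nat 1, IsUpdated orc s s' i := by
  refine Prog.Ensures.setNat_seq (Prog.Ensures.mono (Prog.ensures_loop (c := 79)
    (fun k s' => s'.nat 4 = k ∧ (∀ i < k, IsUpdated orc s s' i) ∧
      ∀ i, k ≤ i → s'.arr 3 i = s.arr 3 i ∧ s'.arr 2 i = s.arr 2 i)
    (n := s.nat 1) rfl ⟨rfl, by simp, by simp⟩ ?_) le_rfl fun _ _ h => h.2.1)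
    (by simp only [NExpr.size]; linarith)
  rintro k - s' hframe ⟨rfl, hdone, htodo⟩
  have hreg : s'.nat 3 = s.nat 3 := hframe.nat_eq 3 (by decide)
  have hgain : storedGain orc s' = storedGain orc s := by
    funext i
    rw [storedGain, storedGain, hreg, hframe.nat_eq 2 (by decide), hframe.arr_eq 0 (by decide)]
    rfl
  refine ⟨?_, by simp [updateBody, Prog.time, RExpr.size, NExpr.size]⟩
  rw [updateBody_exec, hgain, hreg, (htodo _ le_rfl).1, (htodo _ le_rfl).2]
  refine ⟨rfl, fun i hi => ?_, fun i hi => ?_⟩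
  · rcases Nat.lt_succ_iff_lt_or_eq.1 hi with hi | rfl
    · exact ⟨by simp [hi.ne, (hdone i hi).potential_eq],
        funext fun j => by simp [hi.ne, (hdone i hi).stake_eq]⟩
    · refine ⟨by simp, funext fun j => ?_⟩
      by_cases hj : j = s.nat 3 <;> simp [hj, (htodo _ le_rfl).2]
  · have hne : i ≠ s'.nat 4 := (Nat.lt_of_succ_le hi).ne'
    constructor <;> funext j <;> simp [hne, htodo i (Nat.le_of_succ_le hi)]

end Programs

section Run

variable {X : Type*} {N m T : ℕ} {B : ℝ} {g : Fin N → X → ℝ} {π : History X m} {s : State}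

/-- The memory `s` holds the parameters of the algorithm and the potentials and stakes of all the
gamblers after the history `π`. -/
structure Represents (g : Fin N → X → ℝ) (B : ℝ) (π : History X m) (s : State) : Prop where
  nat_one : s.nat 1 = N
  nat_two : s.nat 2 = m
  bound : s.arr 0 0 0 = B
  potential_eq : ∀ i : Fin N,
    s.arr 3 i 0 = potential Round.p (gain (learningRate B m) (g i)) π - 1
  stake_eq : ∀ (i : Fin N) (j : Fin (m + 1)),
    s.arr 2 i j = stake Round.p (gain (learningRate B m) (g i)) π j

theorem Represents.storedScore_eq (hs : Represents g B π s) (x : X) (j : Fin (m + 1)) :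
    storedScore (Algorithm.oracle g x) s N j = score (learningRate B m) g π x j := by
  rw [storedScore, score, ← Fin.sum_univ_eq_sum_range
    (fun i => (1 + s.arr 3 i 0) * Algorithm.oracle g x i * s.arr 2 i j)]
  refine Finset.sum_congr rfl fun i _ => ?_
  rw [hs.potential_eq, hs.stake_eq, add_sub_cancel, Algorithm.oracle, dif_pos i.2]

theorem Represents.storedGain_eq (hs : Represents g B π s) {r : Round X m}
    (hp : s.nat 3 = r.p) (hy : s.arr 0 0 1 = r.y) (i : Fin N) :
    storedGain (Algorithm.oracle g r.x) s i = gain (learningRate B m) (g i) r := by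
  rw [storedGain, hp, hy, hs.nat_two, hs.bound, Algorithm.oracle, dif_pos i.2, div_eq_inv_mul]
  rfl

theorem Represents.beforeUpdate (hs : Represents g B π s) (r : Round X m) :
    Represents g B π (forecaster.beforeUpdate g s r) := by
  have hframe := predictProg.frame_exec (Algorithm.oracle g r.x) s
  refine ⟨(hframe.nat_eq 1 (by decide)).trans hs.nat_one,
    (hframe.nat_eq 2 (by decide)).trans hs.nat_two, ?_, fun i => ?_, fun i j => ?_⟩ <;>
    simp only [Algorithm.beforeUpdate, forecaster, State.setArr_arr, State.setNat_arr]
  · simpa [hframe.arr_eq 0 (by decide)] using hs.bound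
  · simpa [hframe.arr_eq 3 (by decide)] using hs.potential_eq i
  · simpa [hframe.arr_eq 2 (by decide)] using hs.stake_eq i j

theorem Represents.update (hg : ∀ i x, |g i x| ≤ B) (hs : Represents g B π s) {r : Round X m}
    (hp : s.nat 3 = r.p) (hy : s.arr 0 0 1 = r.y) :
    Represents g B (r :: π) (updateProg.exec (Algorithm.oracle g r.x) s) := by
  have hframe := updateProg.frame_exec (Algorithm.oracle g r.x) s
  have hgain (i : Fin N) := abs_gain_lt_one (m := m)
    (learningRate_nonneg ((abs_nonneg _).trans (hg i r.x)) m) (hg i)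
    ((learningRate_mul_le_half B m).trans_lt one_half_lt_one)
  have hupdated (i : Fin N) :=
    (updateProg_ensures (Algorithm.oracle g r.x) s).post i (hs.nat_one ▸ i.2)
  refine ⟨(hframe.nat_eq 1 (by decide)).trans hs.nat_one,
    (hframe.nat_eq 2 (by decide)).trans hs.nat_two,
    (congr_fun₂ (hframe.arr_eq 0 (by decide)) 0 0).trans hs.bound, fun i => ?_, fun i j => ?_⟩
  · rw [(hupdated i).potential_eq, hs.storedGain_eq hp hy, hp, hs.potential_eq,
      hs.stake_eq, potential_cons (hgain i)]
    ring
  · rw [(hupdated i).stake_eq, hs.storedGain_eq hp hy, hp, hs.stake_eq]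
    rcases eq_or_ne r.p j with rfl | hj
    · rw [Function.update_self, stake_cons_self (hgain i)]
    · rw [Function.update_of_ne (Fin.val_ne_of_ne hj.symm), stake_cons_of_ne hj, hs.stake_eq]

theorem discretization_spec (T N : ℕ) (B : ℝ) :
    forecaster.discretization T N B ^ 3 ≤ T ∧ T < (forecaster.discretization T N B + 1) ^ 3 :=
  (cubeRootProg_ensures _ (Algorithm.input T N B) rfl).post

theorem discretization_pos (hT : 1 ≤ T) (N : ℕ) (B : ℝ) :
    0 < forecaster.discretization T N B := by
  by_contra! hzero
  have hlt := (discretization_spec T N B).2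
  rw [Nat.le_zero.1 hzero] at hlt
  omega

theorem discretization_le (T N : ℕ) (B : ℝ) : forecaster.discretization T N B ≤ T :=
  (Nat.le_self_pow (by norm_num) _).trans (discretization_spec T N B).1

theorem represents_stateAfter (hg : ∀ i x, |g i x| ≤ B)
    (hm : forecaster.discretization T N B = m) (π : History X m) :
    Represents g B π (forecaster.stateAfter g T B π) := by
  induction π with
  | nil =>
    have hframe := cubeRootProg.frame_exec (fun _ => 0) (Algorithm.input T N B)
    have harr (a i j : ℕ) : (forecaster.stateAfter (m := m) g T B []).arr a i j =
        if a = 0 ∧ i = 0 ∧ j = 0 then B else 0 :=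
      congr_fun₂ (hframe.arr_eq a (by simp [cubeRootProg, Prog.arrays])) i j
    exact ⟨hframe.nat_eq 1 (by decide), hm, by simp [harr], fun i => by simp [harr],
      fun i j => by simp [harr, stake, wealth]⟩
  | cons r π ih => exact (ih.beforeUpdate r).update hg rfl (by simp [Algorithm.beforeUpdate])

theorem isBalanced_weights (hT : 1 ≤ T) (hg : ∀ i x, |g i x| ≤ B)
    (hm : forecaster.discretization T N B = m) (π : History X m) (x : X) :
    IsBalanced m (score (learningRate B m) g π x) (forecaster.weights g T B π x) := by
  have hs := represents_stateAfter hg hm π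
  have hbalanced := (predictProg_ensures (Algorithm.oracle g x) _
    (hm ▸ discretization_pos hT N B) hs.nat_two).post
  simp only [hs.nat_one, hs.storedScore_eq] at hbalanced
  exact hbalanced

theorem runTime_le (hT : 1 ≤ T) (hN : 1 ≤ N) (hg : ∀ i x, |g i x| ≤ B)
    (hm : forecaster.discretization T N B = m) (π : History X m) :
    forecaster.runTime g T B π ≤ N * (2 + 25 * T + π.length * (209 + 53 * T)) := by
  have hmT : m ≤ T := hm ▸ discretization_le T N B
  induction π with
  | nil =>
    have hinit : forecaster.runTime (m := m) g T B [] ≤ 2 + T * 25 :=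
      (cubeRootProg_ensures _ (Algorithm.input T N B) rfl).time_le
    rw [List.length_nil]
    nlinarith
  | cons r π ih =>
    have hs := represents_stateAfter hg hm π
    have hpredict := (predictProg_ensures (Algorithm.oracle g r.x) _
      (hm ▸ discretization_pos hT N B) hs.nat_two).time_le
    have hupdate := (updateProg_ensures (Algorithm.oracle g r.x)
      (forecaster.beforeUpdate g (forecaster.stateAfter g T B π) r)).time_le
    rw [hs.nat_one] at hpredict
    rw [(hs.beforeUpdate r).nat_one] at hupdate
    have hscores : (m + 1) * (28 + N * 24) ≤ (T + 1) * (52 * N) :=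
      Nat.mul_le_mul (by omega) (by omega)
    have hdraw : m + 1 ≤ (T + 1) * N := (by omega : m + 1 ≤ T + 1).trans
      (Nat.le_mul_of_pos_right _ hN)
    calc forecaster.runTime g T B (r :: π)
        ≤ N * (2 + 25 * T + π.length * (209 + 53 * T)) +
            (72 + (m + 1) * (28 + N * 24)) + (m + 1) + (4 + N * 80) := by
          rw [Algorithm.runTime]
          gcongr
          exacts [hpredict, hupdate]
      _ ≤ N * (2 + 25 * T + π.length * (209 + 53 * T)) + 72 * N + (T + 1) * (52 * N) +
            (T + 1) * N + 84 * N := by omega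
      _ = N * (2 + 25 * T + (r :: π).length * (209 + 53 * T)) := by
          rw [List.length_cons]
          ring

end Run

open MeasureTheory in
theorem integrable_and_integral_le {Ω : Type*} [MeasurableSpace Ω] {μ : Measure Ω}
    [IsProbabilityMeasure μ] {f : Ω → ℝ} {c : ℝ} (hf : AEStronglyMeasurable f μ)
    (hnonneg : ∀ ω, 0 ≤ f ω) (hle : ∀ ω, f ω ≤ c) : Integrable f μ ∧ ∫ ω, f ω ∂μ ≤ c := by
  have hint : Integrable f μ := .of_bound hf c <| .of_forall fun ω => by
    rw [Real.norm_of_nonneg (hnonneg ω)]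
    exact hle ω
  exact ⟨hint, (integral_mono hint (integrable_const c) hle).trans (by simp)⟩

end Multicalibration

open Multicalibration MeasureTheory Polynomial in
theorem theorem2_general :
    ∃ (alg : Algorithm) (C : ℝ) (q : Polynomial ℕ),
      ∀ (X : Type*) (H : Set (X → ℝ)) (B β : ℝ) (N : ℕ) (g : Fin N → X → ℝ) (T : ℕ),
        H.Nonempty → (∀ i x, |g i x| ≤ B) → (∀ h ∈ H, ∃ i, ∀ x, |h x - g i x| ≤ β) → 1 ≤ T →
        0 < alg.discretization T N B ∧
        (∀ (π : History X (alg.discretization T N B)) (x : X),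
          alg.weights g T B π x ∈ stdSimplex ℝ (Fin (alg.discretization T N B + 1))) ∧
        (∀ π : History X (alg.discretization T N B),
          π.length = T → alg.runTime g T B π ≤ N * q.eval T) ∧
        (∀ (Ω : Type*) [MeasurableSpace Ω] (μ : Measure Ω) [IsProbabilityMeasure μ]
          (A : Ω → Adversary X (alg.discretization T N B)),
          AEStronglyMeasurable (fun ω => alg.expectedError g T B H (A ω)) μ →
          Integrable (fun ω => alg.expectedError g T B H (A ω)) μ ∧
          ∫ ω, alg.expectedError g T B H (A ω) ∂μ ≤
            C * (B * (T : ℝ) ^ (-(1 / 3) : ℝ) *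
              √(Real.log (6 * (T : ℝ) * (N : ℝ)))) + β) := by
  refine ⟨forecaster, 10, 2 + 25 * X + X * (209 + 53 * X), ?_⟩
  intro X H B β N g T hH hg hcover hT
  have hN : Nonempty (Fin N) := by
    obtain ⟨h, hh⟩ := hH
    exact ⟨(hcover h hh).choose⟩
  have hbalanced := isBalanced_weights hT hg rfl
  have hsimplex (π : History X _) (x : X) := (hbalanced π x).mem_stdSimplex
  refine ⟨discretization_pos hT N B, hsimplex, fun π hπ => ?_, fun Ω _ μ _ A hA =>
    integrable_and_integral_le hA
      (fun ω => expectedValue_multicalError_nonneg hsimplex (A ω) T) fun ω => ?_⟩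
  · have htime := runTime_le hT (Fin.pos_iff_nonempty.2 hN) hg rfl π
    simpa [hπ] using htime
  · have hcube := discretization_spec T N B
    simpa only [Fintype.card_fin, Algorithm.expectedError] using expectedValue_multicalError_le_rate
      (discretization_pos hT N B) hcube.1 hcube.2 hg hbalanced hH hcover (A ω)

/-- One algorithm, one constant `C` and one polynomial `q` serve all instances.  The algorithm has
query access to an arbitrary enumeration `e` of the minimal cover `Hβ`.  A randomized adversary is
a random choice `ω` of a deterministic adaptive one. -/
theorem theorem2 :
    ∃ (alg : Multicalibration.Algorithm) (C : ℝ) (q : Polynomial ℕ),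
      ∀ (X : Type*) (H : Set (X → ℝ)) (B β : ℝ) (Hβ : Finset (X → ℝ))
        (e : Fin Hβ.card ≃ Hβ) (T : ℕ),
        H.Nonempty → (∀ h ∈ H, ∀ x, |h x| ≤ B) → 0 ≤ β →
        Multicalibration.IsMinimalCover H β Hβ → 1 ≤ T →
        -- the forecasts are drawn from a distribution on `{0, 1/m, …, 1}` with `m ≥ 1`
        0 < alg.discretization T Hβ.card B ∧
        (∀ (π : Multicalibration.History X (alg.discretization T Hβ.card B)) (x : X),
          π.length < T →
          alg.weights (fun i => (e i : X → ℝ)) T B π x ∈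
            stdSimplex ℝ (Fin (alg.discretization T Hβ.card B + 1))) ∧
        -- the running time is linear in the size of the cover and polynomial in `T`
        (∀ π : Multicalibration.History X (alg.discretization T Hβ.card B),
          π.length = T →
          alg.runTime (fun i => (e i : X → ℝ)) T B π ≤ Hβ.card * q.eval T) ∧
        -- the expected error against every (possibly randomized, adaptive) adversary
        (∀ (Ω : Type*) [MeasurableSpace Ω] (μ : MeasureTheory.Measure Ω)
          [MeasureTheory.IsProbabilityMeasure μ]
          (A : Ω → Multicalibration.Adversary X (alg.discretization T Hβ.card B)),
          MeasureTheory.AEStronglyMeasurable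
            (fun ω => alg.expectedError (fun i => (e i : X → ℝ)) T B H (A ω)) μ →
          MeasureTheory.Integrable
            (fun ω => alg.expectedError (fun i => (e i : X → ℝ)) T B H (A ω)) μ ∧
          ∫ ω, alg.expectedError (fun i => (e i : X → ℝ)) T B H (A ω) ∂μ ≤
            C * (B * (T : ℝ) ^ (-(1 / 3) : ℝ) *
              Real.sqrt (Real.log (6 * (T : ℝ) * (Hβ.card : ℝ)))) + β) := by
  obtain ⟨alg, C, q, hgeneral⟩ := theorem2_general
  refine ⟨alg, C, q, fun X H B β Hβ e T hH hB _ ⟨⟨hsub, hcover⟩, _⟩ hT => ?_⟩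
  have hresult := hgeneral X H B β Hβ.card (fun i => e i) T hH (fun i => hB _ (hsub (e i).2))
    (fun h hh => have ⟨f, hf, hhf⟩ := hcover h hh; ⟨e.symm ⟨f, hf⟩, by simpa using hhf⟩) hT
  exact ⟨hresult.1, fun π x _ => hresult.2.1 π x, hresult.2.2⟩
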